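/- Let $(M,g)$ be a smooth $2$-dimensional pseudo-Riemannian manifold (any signature, Riemannian included). Local coordinates $(x^1,x^2)$ on $M$ induce coordinates $(x^1,x^2,p_1,p_2)$ on $T^*M$, in which the Hamiltonian of the geodesic flow is $H=\tfrac12\sum_{k,m}g^{km}(x)p_kp_m$. Let $X_1,\dots,X_N$ be smooth vector fields on $M$ and let $$f=\prod_{m=1}^N(\alpha_m^1p_1+\alpha_m^2p_2),\qquad X_m=\alpha_m^1\partial_{x^1}+\alpha_m^2\partial_{x^2},$$ be the corresponding function on $T^*M$, homogeneous of degree $N$ in the momenta. Suppose that $f$ is a first integral of the geodesic flow, i.e. $\{f,H\}=0$. Let $p\in M$ be a point such that two of the factors are distinct at $p$, i.e. $X_i(p)$ and $X_j(p)$ are linearly independent for some $i,j$, and such that $f$ does not vanish identically on $T^*U$ for any neighbourhood $U$ of $p$. Say that a point $q\in M$ has normal coordinates if there are smooth coordinates $(x^1,x^2)$ on a neighbourhood of $q$ in which $$H=\tfrac12\epsilon_1p_1^2+g^{12}(x^1,x^2)\,p_1p_2+\tfrac12\epsilon_2p_2^2,\qquad \epsilon_1,\epsilon_2\in\{-1,0,1\}\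 \text{constant},$$ $$f=a\,p_1p_2\prod_{i=1}^{N-2}(\alpha_i^1p_1+\alpha_i^2p_2),$$ where $g^{12}$, $\alpha_i^k$ and $a$ are smooth functions of $(x^1,x^2)$ (the $\alpha_i^k$ being new functions), $a$ vanishes nowhere, and $a\equiv1$ if $N\ge3$. Then: 1. There is a neighbourhood of $p$ in which the points having normal coordinates are dense. 2. If each of the vector fields $X_i$ and $X_j$ is either non-null at $p$ (that is, $g(X,X)(p)\ne0$) or null on a whole neighbourhood of $p$, then $p$ itself has normal coordinates. (This condition always holds if $g$ is definite.) -/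

import Mathlib

open Set Filter Topology Manifold Bundle
open scoped ContDiff

namespace GeodesicFlow

/-- The model plane `ℝ²`, used both for positions `(x¹, x²)` and for momenta `(p₁, p₂)`. -/
abbrev Plane : Type := EuclideanSpace ℝ (Fin 2)

/-- The `k`-th standard basis vector of `ℝ²`. -/
noncomputable abbrev stdVec (k : Fin 2) : Plane := EuclideanSpace.single k (1 : ℝ)

/-- The canonical Poisson bracket
`{F, G} = ∑ᵢ (∂F/∂xⁱ ∂G/∂pᵢ - ∂F/∂pᵢ ∂G/∂xⁱ)` of two functions of `(x, p)`. -/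
noncomputable def poisson (F G : Plane → Plane → ℝ) (x p : Plane) : ℝ :=
  ∑ i : Fin 2,
    (fderiv ℝ (fun x' => F x' p) x (stdVec i) * fderiv ℝ (fun p' => G x p') p (stdVec i)
      - fderiv ℝ (fun p' => F x p') p (stdVec i) * fderiv ℝ (fun x' => G x' p) x (stdVec i))

section Manifold

variable (M : Type*) [TopologicalSpace M] [ChartedSpace Plane M] [IsManifold (𝓡 2) ∞ M]

/-- A smooth pseudo-Riemannian metric (of any signature) on a surface: a smooth field of
symmetric nondegenerate bilinear forms on the tangent spaces. -/
structure PseudoMetric where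
  form : ∀ x : M, TangentSpace (𝓡 2) x →L[ℝ] TangentSpace (𝓡 2) x →L[ℝ] ℝ
  symm : ∀ x v w, form x v w = form x w v
  nondegenerate : ∀ x v, (∀ w, form x v w = 0) → v = 0
  smooth : ContMDiff (𝓡 2) ((𝓡 2).prod 𝓘(ℝ, Plane →L[ℝ] Plane →L[ℝ] ℝ)) ∞
    (fun x => TotalSpace.mk' (Plane →L[ℝ] Plane →L[ℝ] ℝ)
      (E := fun x : M => TangentSpace (𝓡 2) x →L[ℝ] TangentSpace (𝓡 2) x →L[ℝ] ℝ) x (form x))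

/-- A smooth vector field on `M`. As a function on covectors it is the linear form
`α¹ p₁ + α² p₂` with smooth coefficients. -/
structure SmoothField where
  toFun : ∀ x : M, TangentSpace (𝓡 2) x
  smooth : ContMDiff (𝓡 2) (𝓡 2).tangent ∞ (fun x => (⟨x, toFun x⟩ : TangentBundle (𝓡 2) M))

variable {M}

/-- The coordinate vector field `∂/∂xᵏ` of the chart `e`, at the point with coordinates `y`. -/
noncomputable def coordVec (e : OpenPartialHomeomorph M Plane) (y : Plane) (k : Fin 2) :
    TangentSpace (𝓡 2) (e.symm y) :=
  mfderiv (𝓡 2) (𝓡 2) e.symm y (stdVec k)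

/-- The covector `p₁ dx¹ + p₂ dx²` at the point with coordinates `y` in the chart `e`. -/
noncomputable def coordCovec (e : OpenPartialHomeomorph M Plane) (y p : Plane) :
    TangentSpace (𝓡 2) (e.symm y) →L[ℝ] ℝ :=
  ∑ k : Fin 2, p k •
    (EuclideanSpace.proj k : Plane →L[ℝ] ℝ).comp
      (mfderiv (𝓡 2) (𝓡 2) e (e.symm y))

/-- The matrix `(g_{km})` of the metric in the chart `e`. -/
noncomputable def PseudoMetric.coeff (g : PseudoMetric M) (e : OpenPartialHomeomorph M Plane)
    (y : Plane) : Matrix (Fin 2) (Fin 2) ℝ :=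
  Matrix.of fun k m => g.form (e.symm y) (coordVec e y k) (coordVec e y m)

/-- The Hamiltonian `H = ½ g^{km} p_k p_m` of the geodesic flow in the coordinates `(x, p)`
induced by the chart `e`; here `(g^{km})` is the inverse of `(g_{km})`. -/
noncomputable def PseudoMetric.hamiltonian (g : PseudoMetric M)
    (e : OpenPartialHomeomorph M Plane) (y p : Plane) : ℝ :=
  (1 / 2) * ∑ k : Fin 2, ∑ m : Fin 2, (g.coeff e y)⁻¹ k m * p k * p m

/-- The function `∏ₘ (α¹ₘ p₁ + α²ₘ p₂)` on covectors, a product of `N` linear forms. -/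
noncomputable def factorized {N : ℕ} (X : Fin N → SmoothField M) (x : M)
    (ξ : TangentSpace (𝓡 2) x →L[ℝ] ℝ) : ℝ :=
  ∏ m : Fin N, ξ ((X m).toFun x)

/-- The function `factorized X` in the coordinates `(x, p)` induced by the chart `e`. -/
noncomputable def factorizedCoord {N : ℕ} (X : Fin N → SmoothField M)
    (e : OpenPartialHomeomorph M Plane) (y p : Plane) : ℝ :=
  factorized X (e.symm y) (coordCovec e y p)

/-- `factorized X` is a first integral of the geodesic flow of `g`: its Poisson bracket with the
Hamiltonian vanishes, in the coordinates on the cotangent bundle induced by any chart. -/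
def IsIntegral (g : PseudoMetric M) {N : ℕ} (X : Fin N → SmoothField M) : Prop :=
  ∀ e ∈ IsManifold.maximalAtlas (𝓡 2) ∞ M, ∀ y ∈ e.target, ∀ p : Plane,
    poisson (factorizedCoord X e) (g.hamiltonian e) y p = 0

/-- In the coordinates induced by the chart `e`,
`H = ½ ε₁ p₁² + g¹² p₁ p₂ + ½ ε₂ p₂²` with constants `ε₁, ε₂ ∈ {-1, 0, 1}`. -/
def HamiltonianNormalForm (g : PseudoMetric M) (e : OpenPartialHomeomorph M Plane) : Prop :=
  ∃ ε₁ ∈ ({-1, 0, 1} : Set ℝ), ∃ ε₂ ∈ ({-1, 0, 1} : Set ℝ), ∃ g12 : Plane → ℝ,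
    ContDiffOn ℝ ∞ g12 e.target ∧
    ∀ y ∈ e.target, ∀ p : Plane,
      g.hamiltonian e y p
        = (1 / 2) * ε₁ * p 0 ^ 2 + g12 y * p 0 * p 1 + (1 / 2) * ε₂ * p 1 ^ 2

/-- In the coordinates induced by the chart `e`,
`f = a p₁ p₂ ∏_{i=1}^{N-2} (α¹ᵢ p₁ + α²ᵢ p₂)` with smooth coefficients and a nowhere zero
function `a`, which is `1` unless the remaining product is empty. -/
def IntegralNormalForm {N : ℕ} (X : Fin N → SmoothField M)
    (e : OpenPartialHomeomorph M Plane) : Prop :=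
  ∃ (a : Plane → ℝ) (α₁ α₂ : Fin (N - 2) → Plane → ℝ),
    ContDiffOn ℝ ∞ a e.target ∧ (∀ y ∈ e.target, a y ≠ 0) ∧
    (3 ≤ N → ∀ y ∈ e.target, a y = 1) ∧
    (∀ i, ContDiffOn ℝ ∞ (α₁ i) e.target) ∧ (∀ i, ContDiffOn ℝ ∞ (α₂ i) e.target) ∧
    ∀ y ∈ e.target, ∀ p : Plane,
      factorizedCoord X e y p
        = a y * p 0 * p 1 * ∏ i : Fin (N - 2), (α₁ i y * p 0 + α₂ i y * p 1)

/-- Around `q` there are smooth coordinates in which both the Hamiltonian and the integral have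
their normal forms. -/
def HasNormalCoordinates (g : PseudoMetric M) {N : ℕ} (X : Fin N → SmoothField M) (q : M) : Prop :=
  ∃ e ∈ IsManifold.maximalAtlas (𝓡 2) ∞ M, q ∈ e.source ∧
    HamiltonianNormalForm g e ∧ IntegralNormalForm X e

/-- At `p` the vector field `X` is non-null, or it is null on a whole neighbourhood of `p`. -/
def NullConstantAt (g : PseudoMetric M) (X : SmoothField M) (p : M) : Prop :=
  g.form p (X.toFun p) (X.toFun p) ≠ 0 ∨
    ∀ᶠ q in 𝓝 p, g.form q (X.toFun q) (X.toFun q) = 0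

end Manifold

end GeodesicFlow

/-!
The product of linear forms `f` is constant along the trajectories of the Hamiltonian `H`, and this
is used twice.

*Unique continuation.* If `f` vanishes on the fibres over an open set, then it vanishes on the
fibres over every coordinate ball that meets this set: at a point where a ball inside the zero
region touches its boundary, the trajectory with velocity pointing to the centre of the ball enters
the region at once, as do all neighbouring trajectories, so `f` vanishes on an open set of
covectors over nearby points; being a product of linear forms, it vanishes on the whole fibres
(`eventually_exists_eq_zero_of_ball`, `eventually_frequently_ne_zero`). Hence, near `p`, the points
where `f` does not vanish identically are dense.

*Invariance of the factors.* Coordinates are chosen in which `X_i` is proportional to `∂₁` and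
`X_j` to `∂₂`: the two coordinates are first integrals of `X_j` and of `X_i`
(`exists_adaptedChart`). At a generic point every coefficient of a factor is nonzero or locally
zero, so the zero set of `f` near the covector `dx²` is exactly `p₁ = 0`. The trajectory starting
at `dx²` stays in it, so `∂H/∂x¹ = 0` there, that is, `∂g²²/∂x¹ = 0`; by density this holds
everywhere (`fderiv_diagonal_eq_zero`), and symmetrically `∂g¹¹/∂x² = 0`.

Since `g²²` is a nonzero multiple of `g(∂₁, ∂₁)`, the condition on `X_i` says that `g²²`, a function
of `x²` alone, is nonzero at `p` or zero near `p`. In the first case replacing `x²` by a primitive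
of `|g²²|^{-1/2}` turns `g²²` into `±1`; likewise for `g¹¹` and `x¹`. These changes of
coordinates have a diagonal differential, so they preserve the form of `X_i` and `X_j`, and the
nonvanishing factor in `f` is absorbed into one of the remaining linear forms
(`hasNormalCoordinates_of_nullConstantAt`). The conditions on `X_i` and `X_j` hold at a dense set of
points, which gives the density statement.

First integrals of a vector field come from its flow, whose smoothness in the initial value is
proved by applying the implicit function theorem to the integral equation on the Banach space of
continuous curves; superposition operators `y ↦ V ∘ y` are smooth there (`contDiff_postcomp`,
`exists_smooth_localFlow`).
-/

namespace GeodesicFlow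

/-! ### Superposition operators on spaces of continuous curves -/

section Nemytskii

universe u

variable {K : Type*} {F G : Type u} [TopologicalSpace K] [CompactSpace K]
  [NormedAddCommGroup F] [NormedSpace ℝ F] [NormedAddCommGroup G] [NormedSpace ℝ G]

set_option synthInstance.maxHeartbeats 200000

/-- Pointwise application `(A, y) ↦ (t ↦ A t (y t))` as a bounded bilinear map between spaces of
continuous functions. -/
noncomputable def pointwiseApply (K : Type*) (F G : Type u) [TopologicalSpace K] [CompactSpace K]
    [NormedAddCommGroup F] [NormedSpace ℝ F] [NormedAddCommGroup G] [NormedSpace ℝ G] :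
    C(K, F →L[ℝ] G) →L[ℝ] C(K, F) →L[ℝ] C(K, G) :=
  LinearMap.mkContinuous₂
    (LinearMap.mk₂ ℝ (fun (A : C(K, F →L[ℝ] G)) (y : C(K, F)) =>
        (⟨fun t => A t (y t), A.continuous.clm_apply y.continuous⟩ : C(K, G)))
      (fun _ _ _ => by ext; simp) (fun _ _ _ => by ext; simp)
      (fun _ _ _ => by ext; simp) (fun _ _ _ => by ext; simp))
    1 (fun A y => by
      rw [ContinuousMap.norm_le _ (by positivity)]
      intro t
      simpa using (A t).le_of_opNorm_le_of_le (A.norm_coe_le_norm t) (y.norm_coe_le_norm t))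

/-- The superposition operator `y ↦ V ∘ y` of a `C¹` map is differentiable, with derivative
`v ↦ (DV ∘ y) v`. -/
lemma hasFDerivAt_postcomp {V : F → G} (hV : ContDiff ℝ 1 V) (y : C(K, F)) :
    HasFDerivAt (fun z : C(K, F) => (⟨V, hV.continuous⟩ : C(F, G)).comp z)
      (pointwiseApply K F G
        ((⟨fderiv ℝ V, hV.continuous_fderiv one_ne_zero⟩ : C(F, F →L[ℝ] G)).comp y)) y := by
  rw [hasFDerivAt_iff_isLittleO_nhds_zero, Asymptotics.isLittleO_iff]
  intro c hc
  have hcont := ContinuousMap.continuous_postcomp (X := K)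
    (⟨fderiv ℝ V, hV.continuous_fderiv one_ne_zero⟩ : C(F, F →L[ℝ] G))
  obtain ⟨δ, hδ, hd⟩ := Metric.mem_nhds_iff.1
    (hcont.continuousAt.preimage_mem_nhds (Metric.ball_mem_nhds (α := C(K, F →L[ℝ] G)) _ hc))
  filter_upwards [Metric.ball_mem_nhds (0 : C(K, F)) hδ] with v hv
  rw [mem_ball_zero_iff] at hv
  rw [ContinuousMap.norm_le _ (by positivity)]
  intro t
  have key : ∀ w ∈ segment ℝ (y t) (y t + v t), ‖fderiv ℝ V w - fderiv ℝ V (y t)‖ ≤ c := by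
    intro w hw
    rw [segment_eq_image'] at hw
    obtain ⟨s, hs, rfl⟩ := hw
    have h1 : dist (y + s • v) y < δ := by
      rw [dist_eq_norm, add_sub_cancel_left, norm_smul, Real.norm_of_nonneg hs.1]
      exact lt_of_le_of_lt (mul_le_of_le_one_left (norm_nonneg _) hs.2) hv
    have h2 := (ContinuousMap.dist_apply_le_dist t).trans (Metric.mem_ball.1 (hd (Metric.mem_ball.2 h1))).le
    simpa [dist_eq_norm] using h2
  have := (convex_segment (y t) (y t + v t)).norm_image_sub_le_of_norm_fderiv_le'
    (fun w _ => (hV.differentiable one_ne_zero).differentiableAt) key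
    (left_mem_segment ℝ _ _) (right_mem_segment ℝ _ _)
  simp only [add_sub_cancel_left] at this
  exact this.trans (mul_le_mul_of_nonneg_left (v.norm_coe_le_norm t) hc.le)

/-- The derivative of a superposition operator is built from the superposition operator of `DV`, so
the regularity improves by induction. The codomain varies in the induction, hence the common
universe of `F` and `G`. -/
lemma contDiff_postcomp_nat (n : ℕ) : ∀ {G : Type u} [NormedAddCommGroup G] [NormedSpace ℝ G]
    {V : F → G} (hV : ContDiff ℝ ∞ V),
    ContDiff ℝ n (fun z : C(K, F) => (⟨V, hV.continuous⟩ : C(F, G)).comp z) := by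
  induction n with
  | zero =>
    intro G _ _ V hV
    exact contDiff_zero.2 (ContinuousMap.continuous_postcomp _)
  | succ n ih =>
    intro G _ _ V hV
    rw [Nat.cast_succ, contDiff_succ_iff_hasFDerivAt]
    refine ⟨_, ?_, fun y => hasFDerivAt_postcomp (hV.of_le (by simp)) y⟩
    exact (pointwiseApply K F G).contDiff.comp (ih (hV.fderiv_right (m := ∞) (by simp)))

/-- The superposition operator of a smooth map is smooth. -/
lemma contDiff_postcomp {V : F → G} (hV : ContDiff ℝ ∞ V) :
    ContDiff ℝ ∞ (fun z : C(K, F) => (⟨V, hV.continuous⟩ : C(F, G)).comp z) :=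
  contDiff_infty.2 fun n => contDiff_postcomp_nat n hV

end Nemytskii

/-! ### Smooth dependence of flows on initial values -/

/-- The implicit function theorem for smooth equations, with smoothness of the solution on a whole
neighbourhood of the base point. -/
lemma exists_implicitFunction {E₁ E₂ F : Type*} [NormedAddCommGroup E₁] [NormedSpace ℝ E₁]
    [CompleteSpace E₁] [NormedAddCommGroup E₂] [NormedSpace ℝ E₂] [CompleteSpace E₂]
    [NormedAddCommGroup F] [NormedSpace ℝ F] [CompleteSpace F] {f : E₁ × E₂ → F}
    (hf : ContDiff ℝ ∞ f) (u : E₁ × E₂)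
    (hu : (fderiv ℝ f u ∘SL ContinuousLinearMap.inr ℝ E₁ E₂).IsInvertible) :
    ∃ Y : E₁ → E₂, (∀ᶠ z in 𝓝 u, f z = f u ↔ Y z.1 = z.2) ∧ Y u.1 = u.2 ∧
      ∀ᶠ x in 𝓝 u.1, ContDiffAt ℝ ∞ Y x := by
  have h0 : (∞ : WithTop ℕ∞) ≠ 0 := by simp
  set Y := (hf.contDiffAt (x := u)).implicitFunction h0 hu with hY
  have hiff := (hf.contDiffAt (x := u)).eventually_apply_eq_iff_implicitFunction h0 hu
  have hYu : Y u.1 = u.2 := hiff.self_of_nhds.1 rfl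
  have hYc : ContinuousAt Y u.1 :=
    ((hf.contDiffAt (x := u)).contDiffAt_implicitFunction h0 hu).continuousAt
  refine ⟨Y, hiff, hYu, ?_⟩
  have hinv : ∀ᶠ z in 𝓝 u,
      (fderiv ℝ f z ∘SL ContinuousLinearMap.inr ℝ E₁ E₂).IsInvertible := by
    have hc : Continuous fun z => fderiv ℝ f z ∘SL ContinuousLinearMap.inr ℝ E₁ E₂ :=
      (hf.continuous_fderiv h0).clm_comp continuous_const
    exact hc.continuousAt.eventually (ContinuousLinearEquiv.isOpen.mem_nhds hu)
  have hgraph : Tendsto (fun x => (x, Y x)) (𝓝 u.1) (𝓝 u) := by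
    have := continuousAt_id.prodMk hYc
    rwa [ContinuousAt, hYu] at this
  filter_upwards [hgraph.eventually (hinv.and hiff.eventually_nhds)] with x ⟨hx1, hx2⟩
  -- near `x` the solution coincides with the implicit function based at `(x, Y x)`
  set Z := (hf.contDiffAt (x := (x, Y x))).implicitFunction h0 hx1 with hZ
  have hZs : ContDiffAt ℝ ∞ Z x :=
    (hf.contDiffAt (x := (x, Y x))).contDiffAt_implicitFunction h0 hx1
  have hfx : f (x, Y x) = f u := hx2.self_of_nhds.2 rfl
  have hZx : Z x = Y x := by
    have := ((hf.contDiffAt (x := (x, Y x))).eventually_apply_eq_iff_implicitFunction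
      h0 hx1).self_of_nhds.1 rfl
    exact this
  have hgz : Tendsto (fun x' => (x', Z x')) (𝓝 x) (𝓝 (x, Y x)) := by
    have := continuousAt_id.prodMk hZs.continuousAt
    rwa [ContinuousAt, hZx] at this
  refine hZs.congr_of_eventuallyEq ?_
  filter_upwards [hgz.eventually hx2, (hf.contDiffAt (x := (x, Y x))).eventually_apply_implicitFunction
    h0 hx1] with x' h1 h2
  exact h1.1 (h2.trans hfx)

section Flow

variable {F : Type*} [NormedAddCommGroup F] [NormedSpace ℝ F]

/-- The antiderivative operator `y ↦ (s ↦ ∫₀ˢ y)` on continuous curves `[0, 1] → F`. -/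
noncomputable def antiderivative (F : Type*) [NormedAddCommGroup F] [NormedSpace ℝ F] :
    C(unitInterval, F) →L[ℝ] C(unitInterval, F) :=
  LinearMap.mkContinuous
    { toFun := fun y =>
        ⟨fun s => ∫ σ in (0 : ℝ)..s, y (projIcc 0 1 zero_le_one σ), by
          have h : Continuous fun σ : ℝ => y (projIcc 0 1 zero_le_one σ) :=
            y.continuous.comp continuous_projIcc
          exact (intervalIntegral.continuous_primitive (fun a b => h.intervalIntegrable a b) 0).comp
            continuous_subtype_val⟩
      map_add' := fun y z => by
        ext s
        have h : ∀ w : C(unitInterval, F), Continuous fun σ : ℝ => w (projIcc 0 1 zero_le_one σ) :=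
          fun w => w.continuous.comp continuous_projIcc
        simp only [ContinuousMap.add_apply, ContinuousMap.coe_mk]
        exact intervalIntegral.integral_add ((h y).intervalIntegrable _ _)
          ((h z).intervalIntegrable _ _)
      map_smul' := fun c y => by
        ext s
        simp }
    1 (fun y => by
      rw [ContinuousMap.norm_le _ (by positivity)]
      intro s
      have h := intervalIntegral.norm_integral_le_of_norm_le_const
        (f := fun σ : ℝ => y (projIcc 0 1 zero_le_one σ)) (a := 0) (b := s) (C := ‖y‖)
        (fun σ _ => y.norm_coe_le_norm _)
      refine h.trans ?_
      rw [sub_zero, abs_of_nonneg s.2.1, mul_comm]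
      exact mul_le_mul_of_nonneg_right s.2.2 (norm_nonneg _))

lemma antiderivative_apply (y : C(unitInterval, F)) (s : unitInterval) :
    antiderivative F y s = ∫ σ in (0 : ℝ)..s, y (projIcc 0 1 zero_le_one σ) := rfl

/-- The map `((ε, c), y) ↦ y - c - ε ∫₀ V(y)`, whose zeros are the trajectories of `ε V` on
`[0, 1]` starting at `c`. -/
noncomputable def trajectoryDefect (V : C(F, F)) (z : (ℝ × F) × C(unitInterval, F)) :
    C(unitInterval, F) :=
  z.2 - ContinuousMap.const _ z.1.2 - z.1.1 • antiderivative F (V.comp z.2)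

lemma trajectoryDefect_eq_zero_iff (V : C(F, F)) (ε : ℝ) (c : F) (y : C(unitInterval, F)) :
    trajectoryDefect V ((ε, c), y) = 0 ↔ ∀ s : unitInterval,
      y s = c + ε • ∫ σ in (0 : ℝ)..s, V (y (projIcc 0 1 zero_le_one σ)) := by
  rw [ContinuousMap.ext_iff]
  refine forall_congr' fun s => ?_
  simp only [trajectoryDefect, ContinuousMap.sub_apply, ContinuousMap.add_apply,
    ContinuousMap.const_apply, ContinuousMap.smul_apply, antiderivative_apply, ContinuousMap.comp_apply,
    ContinuousMap.zero_apply, sub_sub, sub_eq_zero]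

lemma contDiff_trajectoryDefect {V : F → F} (hV : ContDiff ℝ ∞ V) :
    ContDiff ℝ ∞ (trajectoryDefect (⟨V, hV.continuous⟩ : C(F, F))) := by
  have hc : ContDiff ℝ ∞ fun c : F => ContinuousMap.const unitInterval c :=
    (ContinuousLinearMap.mk (⟨⟨fun c : F => ContinuousMap.const unitInterval c,
      fun _ _ => rfl⟩, fun _ _ => rfl⟩ : F →ₗ[ℝ] C(unitInterval, F))
      (ContinuousMap.continuous_const')).contDiff
  unfold trajectoryDefect
  exact (contDiff_snd.sub (hc.comp (contDiff_snd.comp contDiff_fst))).sub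
    ((contDiff_fst.comp contDiff_fst).smul
      ((antiderivative F).contDiff.comp ((contDiff_postcomp hV).comp contDiff_snd)))

/-- If the trajectory of `ε V` from `c` is run only up to time `s`, it becomes a trajectory
of `s ε V`. -/
lemma trajectoryDefect_rescale (V : C(F, F)) {ε : ℝ} {c : F} {y : C(unitInterval, F)}
    (h : trajectoryDefect V ((ε, c), y) = 0) (s : unitInterval) :
    trajectoryDefect V (((s : ℝ) * ε, c),
      y.comp ⟨fun τ => s * τ, continuous_const.mul continuous_id⟩) = 0 := by
  rw [trajectoryDefect_eq_zero_iff] at h ⊢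
  intro τ
  change y (s * τ) = _
  rw [h (s * τ)]
  congr 1
  rw [mul_comm (s : ℝ) ε, mul_smul]
  congr 1
  have h1 : ∀ σ ∈ uIcc (0 : ℝ) τ, V ((y.comp ⟨fun τ => s * τ, continuous_const.mul continuous_id⟩)
      (projIcc 0 1 zero_le_one σ)) =
      (fun σ' : ℝ => V (y (projIcc 0 1 zero_le_one σ'))) (s * σ) := by
    intro σ hσ
    rw [uIcc_of_le τ.2.1] at hσ
    have hσ' : σ ∈ Icc (0 : ℝ) 1 := ⟨hσ.1, hσ.2.trans τ.2.2⟩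
    simp only [ContinuousMap.comp_apply, ContinuousMap.coe_mk]
    congr 2
    rw [projIcc_of_mem zero_le_one hσ',
      projIcc_of_mem zero_le_one (x := s * σ) (s * ⟨σ, hσ'⟩ : unitInterval).2]
    rfl
  rw [intervalIntegral.integral_congr h1, intervalIntegral.smul_integral_comp_mul_left
    (fun σ => V (y (projIcc 0 1 zero_le_one σ))) (s : ℝ)]
  simp

/-- **Smooth dependence on initial values**: a smooth vector field has a smooth local flow near
time `0` and any given point. -/
theorem exists_smooth_localFlow_of_contDiff [CompleteSpace F] {V : F → F} (hV : ContDiff ℝ ∞ V)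
    (x₀ : F) :
    ∃ φ : ℝ × F → F, (∀ᶠ x in 𝓝 x₀, φ (0, x) = x) ∧ ∀ᶠ z in 𝓝 ((0 : ℝ), x₀),
      ContDiffAt ℝ ∞ φ z ∧ HasDerivAt (fun t => φ (t, z.2)) (V (φ z)) z.1 := by
  set VC : C(F, F) := ⟨V, hV.continuous⟩ with hVC
  set y₀ : C(unitInterval, F) := ContinuousMap.const _ x₀ with hy₀
  set u : (ℝ × F) × C(unitInterval, F) := ((0, x₀), y₀) with hu
  have hf := contDiff_trajectoryDefect hV
  -- at `ε = 0` the partial derivative in `y` is the identity, whatever `V` is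
  have hfu : trajectoryDefect VC u = 0 := by
    rw [hu, trajectoryDefect_eq_zero_iff]; intro s; simp [hy₀]
  have hinv : (fderiv ℝ (trajectoryDefect VC) u ∘SL
      ContinuousLinearMap.inr ℝ (ℝ × F) C(unitInterval, F)).IsInvertible := by
    have h1 : HasFDerivAt (fun y => trajectoryDefect VC ((0, x₀), y))
        (fderiv ℝ (trajectoryDefect VC) u ∘SL
          ContinuousLinearMap.inr ℝ (ℝ × F) C(unitInterval, F)) y₀ :=
      ((hf.differentiable (by simp)).differentiableAt.hasFDerivAt).comp y₀
        (hasFDerivAt_prodMk_right (0, x₀) y₀)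
    have h2 : HasFDerivAt (fun y => trajectoryDefect VC ((0, x₀), y))
        (ContinuousLinearMap.id ℝ C(unitInterval, F)) y₀ := by
      have : (fun y => trajectoryDefect VC ((0, x₀), y)) = fun y => y - y₀ := by
        funext y; simp [trajectoryDefect, hy₀]
      rw [this]
      exact (hasFDerivAt_id y₀).sub_const y₀
    rw [h1.unique h2]
    exact ⟨ContinuousLinearEquiv.refl ℝ _, rfl⟩
  obtain ⟨Y, hiff, hYu, hYs⟩ := exists_implicitFunction hf u hinv
  rw [hfu] at hiff
  have hYc : ContinuousAt Y (0, x₀) := hYs.self_of_nhds.continuousAt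
  have hYu : Y (0, x₀) = y₀ := hYu
  -- a uniform box on which local uniqueness holds
  obtain ⟨δ, hδ, hball⟩ := Metric.eventually_nhds_iff_ball.1 hiff
  have hbox : ∀ ε c y, |ε| < δ → dist c x₀ < δ → dist y y₀ < δ →
      (trajectoryDefect VC ((ε, c), y) = 0 ↔ Y (ε, c) = y) := by
    intro ε c y h1 h2 h3
    refine hball ((ε, c), y) ?_
    simp only [Metric.mem_ball, hu, Prod.dist_eq, max_lt_iff, Real.dist_eq, sub_zero]
    exact ⟨⟨h1, h2⟩, h3⟩
  have hYnear : ∀ᶠ z in 𝓝 ((0 : ℝ), x₀), dist (Y z) y₀ < δ := by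
    have := hYc.eventually (Metric.ball_mem_nhds (Y (0, x₀)) hδ)
    rw [hYu] at this
    exact this
  set φ : ℝ × F → F := fun z => Y z 1 with hφ
  have hφs : ∀ᶠ z in 𝓝 ((0 : ℝ), x₀), ContDiffAt ℝ ∞ φ z := by
    filter_upwards [hYs] with z hz
    exact (ContinuousMap.evalCLM ℝ (1 : unitInterval)).contDiff.contDiffAt.comp z hz
  obtain ⟨r, hr, hrball⟩ := Metric.eventually_nhds_iff_ball.1 (hYnear.and hφs)
  set η := min δ r with hη
  have hη0 : 0 < η := lt_min hδ hr
  have hmem : ∀ ε c, |ε| < η → dist c x₀ < η → (ε, c) ∈ Metric.ball ((0 : ℝ), x₀) r := by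
    intro ε c h1 h2
    simp only [Metric.mem_ball, Prod.dist_eq, max_lt_iff, Real.dist_eq, sub_zero]
    exact ⟨h1.trans_le (min_le_right _ _), h2.trans_le (min_le_right _ _)⟩
  have hzero : ∀ ε c, |ε| < η → dist c x₀ < η → trajectoryDefect VC ((ε, c), Y (ε, c)) = 0 :=
    fun ε c h1 h2 => (hbox ε c _ (h1.trans_le (min_le_left _ _)) (h2.trans_le (min_le_left _ _))
      (hrball _ (hmem ε c h1 h2)).1).2 rfl
  -- the trajectory with parameter `ε` is `s ↦ φ (s ε, c)`
  have hscale : ∀ ε c, |ε| < η → dist c x₀ < η → ∀ s : unitInterval,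
      φ (s * ε, c) = Y (ε, c) s := by
    intro ε c h1 h2 s
    have h3 := trajectoryDefect_rescale VC (hzero ε c h1 h2) s
    have h4 : |(s : ℝ) * ε| < δ := by
      rw [abs_mul, abs_of_nonneg s.2.1]
      exact (mul_le_of_le_one_left (abs_nonneg _) s.2.2).trans_lt (h1.trans_le (min_le_left _ _))
    have h5 : dist ((Y (ε, c)).comp ⟨fun τ => s * τ, continuous_const.mul continuous_id⟩) y₀
        < δ := by
      refine lt_of_le_of_lt ?_ (hrball _ (hmem ε c h1 h2)).1
      rw [ContinuousMap.dist_le dist_nonneg]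
      intro τ
      exact ContinuousMap.dist_apply_le_dist (f := Y (ε, c)) (g := y₀) (s * τ)
    have h6 := (hbox _ c _ h4 (h2.trans_le (min_le_left _ _)) h5).1 h3
    rw [hφ]
    simp only [h6, ContinuousMap.comp_apply, ContinuousMap.coe_mk, mul_one]
  have hint : ∀ ε c, |ε| < η → dist c x₀ < η →
      φ (ε, c) = c + ∫ σ in (0 : ℝ)..ε, V (φ (σ, c)) := by
    intro ε c h1 h2
    have h3 := (trajectoryDefect_eq_zero_iff _ _ _ _).1 (hzero ε c h1 h2) 1
    rw [Icc.coe_one] at h3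
    have h4 : ∀ σ ∈ uIcc (0 : ℝ) 1,
        VC (Y (ε, c) (projIcc 0 1 zero_le_one σ)) = (fun σ' => V (φ (σ', c))) (σ * ε) := by
      intro σ hσ
      rw [uIcc_of_le zero_le_one] at hσ
      have := hscale ε c h1 h2 ⟨σ, hσ⟩
      simp only at this
      rw [projIcc_of_mem zero_le_one hσ, ← this]
      rfl
    rw [intervalIntegral.integral_congr h4,
      intervalIntegral.smul_integral_comp_mul_right (fun σ => V (φ (σ, c))) ε] at h3
    simpa using h3
  refine ⟨φ, ?_, ?_⟩
  · filter_upwards [Metric.ball_mem_nhds x₀ hη0] with c hc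
    simpa using hint 0 c (by simpa using hη0) hc
  · filter_upwards [Metric.ball_mem_nhds ((0 : ℝ), x₀) hη0] with z hz
    obtain ⟨ε, c⟩ := z
    simp only [Metric.mem_ball, Prod.dist_eq, max_lt_iff, Real.dist_eq, sub_zero] at hz
    refine ⟨(hrball _ (hmem ε c hz.1 hz.2)).2, ?_⟩
    have hcont : ContinuousOn (fun σ => V (φ (σ, c))) (Metric.ball 0 η) := by
      intro σ hσ
      rw [mem_ball_zero_iff, Real.norm_eq_abs] at hσ
      have h1 := (hrball _ (hmem σ c hσ hz.2)).2.continuousAt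
      have h2 : ContinuousAt (fun σ : ℝ => φ (σ, c)) σ :=
        ContinuousAt.comp (f := fun σ : ℝ => (σ, c)) h1 (by fun_prop)
      exact (hV.continuous.continuousAt.comp h2).continuousWithinAt
    have hmemε : ε ∈ Metric.ball (0 : ℝ) η := by simpa using hz.1
    have hsub : uIcc 0 ε ⊆ Metric.ball (0 : ℝ) η := by
      rw [← segment_eq_uIcc]
      exact (convex_ball (0 : ℝ) η).segment_subset (Metric.mem_ball_self hη0) hmemε
    have hd : HasDerivAt (fun t => ∫ σ in (0 : ℝ)..t, V (φ (σ, c))) (V (φ (ε, c))) ε :=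
      intervalIntegral.integral_hasDerivAt_right ((hcont.mono hsub).intervalIntegrable)
        (hcont.stronglyMeasurableAtFilter Metric.isOpen_ball _ hmemε)
        (hcont.continuousAt (Metric.isOpen_ball.mem_nhds hmemε))
    refine (hd.const_add c).congr_of_eventuallyEq ?_
    filter_upwards [Metric.isOpen_ball.mem_nhds hmemε] with t ht
    exact hint t c (by simpa using ht) hz.2

/-- A function that is smooth on an open set coincides near each of its points with a function
that is smooth everywhere. -/
lemma exists_contDiff_eventuallyEq {E G : Type*} [NormedAddCommGroup E] [NormedSpace ℝ E]
    [FiniteDimensional ℝ E] [NormedAddCommGroup G] [NormedSpace ℝ G] {f : E → G} {U : Set E}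
    (hU : IsOpen U) (hf : ContDiffOn ℝ ∞ f U) {x : E} (hx : x ∈ U) :
    ∃ h : E → G, ContDiff ℝ ∞ h ∧ h =ᶠ[𝓝 x] f := by
  obtain ⟨r, hr, hrU⟩ := Metric.nhds_basis_closedBall.mem_iff.1 (hU.mem_nhds hx)
  let χ : ContDiffBump x := ⟨r / 2, r, by positivity, by linarith⟩
  refine ⟨fun z => χ z • f z, ?_, ?_⟩
  · rw [contDiff_iff_contDiffAt]
    intro z
    by_cases hz : z ∈ Metric.closedBall x r
    · exact χ.contDiff.contDiffAt.smul (hf.contDiffAt (hU.mem_nhds (hrU hz)))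
    · have h0 : (fun z => χ z • f z) =ᶠ[𝓝 z] fun _ => 0 := by
        filter_upwards [Metric.isClosed_closedBall.isOpen_compl.mem_nhds hz] with w hw
        have : χ w = 0 := χ.zero_of_le_dist (by
          simp only [mem_compl_iff, Metric.mem_closedBall, not_le] at hw
          exact hw.le)
        simp [this]
      exact contDiffAt_const.congr_of_eventuallyEq h0
  · filter_upwards [χ.eventuallyEq_one] with w hw
    simp [hw]

/-- A vector field that is smooth on an open set has a smooth local flow near each of its
points. -/
theorem exists_smooth_localFlow [FiniteDimensional ℝ F] {V : F → F} {U : Set F}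
    (hU : IsOpen U) (hV : ContDiffOn ℝ ∞ V U) {x₀ : F} (hx₀ : x₀ ∈ U) :
    ∃ φ : ℝ × F → F, (∀ᶠ x in 𝓝 x₀, φ (0, x) = x) ∧ ∀ᶠ z in 𝓝 ((0 : ℝ), x₀),
      ContDiffAt ℝ ∞ φ z ∧ φ z ∈ U ∧ HasDerivAt (fun t => φ (t, z.2)) (V (φ z)) z.1 := by
  have : CompleteSpace F := FiniteDimensional.complete ℝ F
  obtain ⟨W, hW, hWV⟩ := exists_contDiff_eventuallyEq hU hV hx₀
  obtain ⟨φ, hφ0, hφ⟩ := exists_smooth_localFlow_of_contDiff hW x₀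
  refine ⟨φ, hφ0, ?_⟩
  have hc : Tendsto φ (𝓝 ((0 : ℝ), x₀)) (𝓝 x₀) := by
    have := hφ.self_of_nhds.1.continuousAt
    rwa [ContinuousAt, hφ0.self_of_nhds] at this
  filter_upwards [hφ, hc.eventually hWV, hc.eventually (hU.mem_nhds hx₀)] with z h1 h2 h3
  exact ⟨h1.1, h3, h2 ▸ h1.2⟩

end Flow

/-! ### Local diffeomorphisms and first integrals of vector fields -/

/-- The inverse function theorem for a map that is smooth near a point, with smoothness of the map
and of its inverse on the whole domain. The domain can be taken inside any neighbourhood. -/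
lemma exists_local_diffeomorph {E G : Type*} [NormedAddCommGroup E] [NormedSpace ℝ E]
    [CompleteSpace E] [NormedAddCommGroup G] [NormedSpace ℝ G] {f : E → G} {x₀ : E}
    (hf : ∀ᶠ x in 𝓝 x₀, ContDiffAt ℝ ∞ f x) (hinv : (fderiv ℝ f x₀).IsInvertible)
    {W : Set E} (hW : W ∈ 𝓝 x₀) :
    ∃ ψ : OpenPartialHomeomorph E G, x₀ ∈ ψ.source ∧ ψ.source ⊆ W ∧ (∀ x, ψ x = f x) ∧
      (∀ x ∈ ψ.source, ContDiffAt ℝ ∞ f x) ∧ (∀ y ∈ ψ.target, ContDiffAt ℝ ∞ ψ.symm y) ∧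
      ∀ x ∈ ψ.source, (fderiv ℝ f x).IsInvertible := by
  have h0 : (∞ : WithTop ℕ∞) ≠ 0 := by simp
  obtain ⟨f', hf'⟩ := hinv
  have hd : HasFDerivAt f (f' : E →L[ℝ] G) x₀ := by
    rw [hf']; exact (hf.self_of_nhds.differentiableAt h0).hasFDerivAt
  let ψ₀ := hf.self_of_nhds.toOpenPartialHomeomorph f hd h0
  have hinv' : ∀ᶠ x in 𝓝 x₀, (fderiv ℝ f x).IsInvertible := by
    have hc : ContinuousAt (fderiv ℝ f) x₀ :=
      (hf.self_of_nhds.fderiv_right (m := ∞) (by simp)).continuousAt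
    exact hc.eventually (ContinuousLinearEquiv.isOpen.mem_nhds ⟨f', hf'⟩)
  obtain ⟨s, hs, hso, hxs⟩ := eventually_nhds_iff.1 ((hf.and hinv').and hW)
  let ψ := ψ₀.restrOpen s hso
  have hsrc : ∀ x ∈ ψ.source, x ∈ s := fun x hx => hx.2
  refine ⟨ψ, ⟨hf.self_of_nhds.mem_toOpenPartialHomeomorph_source hd h0, hxs⟩,
    fun x hx => (hs x (hsrc x hx)).2, fun x => rfl, fun x hx => (hs x (hsrc x hx)).1.1, ?_,
    fun x hx => (hs x (hsrc x hx)).1.2⟩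
  intro y hy
  have hx := hs _ (hsrc _ (ψ.map_target hy))
  obtain ⟨g', hg'⟩ := hx.1.2
  refine ψ.contDiffAt_symm (f₀' := g') hy ?_ hx.1.1
  rw [hg']
  exact (hx.1.1.differentiableAt h0).hasFDerivAt

/-- A smooth planar vector field `a` with `a y₀ ≠ 0` has near `y₀` a first integral `u` with
nonvanishing differential; a vector `v` transverse to `a y₀` gives the normalization
`du(v) = 1`. -/
theorem exists_firstIntegral {a : Plane → Plane} {U : Set Plane} (hU : IsOpen U)
    (ha : ContDiffOn ℝ ∞ a U) {y₀ v : Plane} (hy₀ : y₀ ∈ U)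
    (hv : LinearIndependent ℝ ![a y₀, v]) :
    ∃ u : Plane → ℝ, (∀ᶠ y in 𝓝 y₀, ContDiffAt ℝ ∞ u y ∧ fderiv ℝ u y (a y) = 0) ∧
      fderiv ℝ u y₀ v = 1 := by
  have h0 : (∞ : WithTop ℕ∞) ≠ 0 := by simp
  obtain ⟨φ, hφ0, hφ⟩ := exists_smooth_localFlow hU ha hy₀
  -- flow along `a` starting on the line through `y₀` in direction `v`
  set ι : ℝ × ℝ → ℝ × Plane := fun z => (z.1, y₀ + z.2 • v) with hι
  set Ψ : ℝ × ℝ → Plane := fun z => φ (ι z) with hΨ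
  have hιs : ContDiff ℝ ∞ ι :=
    contDiff_fst.prodMk (contDiff_const.add (contDiff_snd.smul contDiff_const))
  have hι0 : ι (0, 0) = (0, y₀) := by simp [hι]
  have hΨ0 : Ψ (0, 0) = y₀ := by rw [hΨ]; simp only [hι0]; exact hφ0.self_of_nhds
  have hιt : Tendsto ι (𝓝 (0, 0)) (𝓝 (0, y₀)) := by
    have := hιs.continuous.tendsto (0, 0); rwa [hι0] at this
  have hφΨ := hιt.eventually hφ
  have hΨs : ∀ᶠ z in 𝓝 ((0 : ℝ), (0 : ℝ)), ContDiffAt ℝ ∞ Ψ z := by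
    filter_upwards [hφΨ] with z hz
    exact hz.1.comp z hιs.contDiffAt
  have hΨt : ∀ᶠ z in 𝓝 ((0 : ℝ), (0 : ℝ)),
      HasDerivAt (fun t => Ψ (t, z.2)) (a (Ψ z)) z.1 := by
    filter_upwards [hφΨ] with z hz
    exact hz.2.2
  have hd0 := (hΨs.self_of_nhds.differentiableAt h0).hasFDerivAt
  have h10 : fderiv ℝ Ψ (0, 0) (1, 0) = a y₀ := by
    have h1 : HasDerivAt (fun t : ℝ => (t, (0 : ℝ))) (1, 0) 0 :=
      (hasDerivAt_id _).prodMk (hasDerivAt_const _ _)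
    have h2 := HasFDerivAt.comp_hasDerivAt (f := fun t : ℝ => (t, (0 : ℝ))) (0 : ℝ) hd0 h1
    have h3 := hΨt.self_of_nhds
    rw [hΨ0] at h3
    exact h2.unique h3
  have h01 : fderiv ℝ Ψ (0, 0) (0, 1) = v := by
    have h1 : HasDerivAt (fun s : ℝ => ((0 : ℝ), s)) (0, 1) 0 :=
      (hasDerivAt_const _ _).prodMk (hasDerivAt_id _)
    have h2 := HasFDerivAt.comp_hasDerivAt (f := fun s : ℝ => ((0 : ℝ), s)) (0 : ℝ) hd0 h1
    have h3 : HasDerivAt (fun s : ℝ => y₀ + s • v) v 0 := by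
      simpa using ((hasDerivAt_id (0 : ℝ)).smul_const v).const_add y₀
    have h4 : (fun s : ℝ => y₀ + s • v) =ᶠ[𝓝 0] Ψ ∘ fun s : ℝ => ((0 : ℝ), s) := by
      have h5 : Tendsto (fun s : ℝ => y₀ + s • v) (𝓝 0) (𝓝 y₀) := by
        have : Continuous fun s : ℝ => y₀ + s • v := by fun_prop
        simpa using this.tendsto 0
      filter_upwards [h5.eventually hφ0] with s hs
      exact hs.symm
    exact h2.unique (h3.congr_of_eventuallyEq h4.symm)
  have hinv : (fderiv ℝ Ψ (0, 0)).IsInvertible := by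
    have hform : ∀ z : ℝ × ℝ, fderiv ℝ Ψ (0, 0) z = z.1 • a y₀ + z.2 • v := by
      intro z
      have : z = z.1 • ((1 : ℝ), (0 : ℝ)) + z.2 • ((0 : ℝ), (1 : ℝ)) := by
        ext <;> simp
      conv_lhs => rw [this]
      rw [map_add, map_smul, map_smul, h10, h01]
    have hinj : Function.Injective (fderiv ℝ Ψ (0, 0) : ℝ × ℝ →ₗ[ℝ] Plane) := by
      rw [injective_iff_map_eq_zero]
      intro z hz
      have h1 : z.1 • a y₀ + z.2 • v = 0 := (hform z).symm.trans hz
      have h2 := LinearIndependent.pair_iff.1 hv z.1 z.2 h1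
      exact Prod.ext h2.1 h2.2
    have hdim : Module.finrank ℝ (ℝ × ℝ) = Module.finrank ℝ Plane := by simp
    refine ⟨(LinearEquiv.ofInjectiveOfFinrankEq _ hinj hdim).toContinuousLinearEquiv, ?_⟩
    ext <;> rfl
  obtain ⟨ψ, h0ψ, hsub, hψ, -, hψs, -⟩ := exists_local_diffeomorph hΨs hinv hΨt
  have hinvl : ∀ z ∈ ψ.source, ψ.symm (Ψ z) = z := fun z hz => by
    rw [← hψ]; exact ψ.left_inv hz
  have hy₀t : y₀ ∈ ψ.target := by
    have := ψ.map_source h0ψ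
    rwa [hψ, hΨ0] at this
  have hus : ∀ y ∈ ψ.target, ContDiffAt ℝ ∞ (fun y => (ψ.symm y).2) y := fun y hy =>
    contDiff_snd.contDiffAt.comp y (hψs y hy)
  refine ⟨fun y => (ψ.symm y).2, ?_, ?_⟩
  · filter_upwards [ψ.open_target.mem_nhds hy₀t] with y hy
    refine ⟨hus y hy, ?_⟩
    set z := ψ.symm y with hz
    have hzs : z ∈ ψ.source := ψ.map_target hy
    have hΨz : Ψ z = y := by rw [← hψ]; exact ψ.right_inv hy
    have h1 : HasDerivAt (fun t => Ψ (t, z.2)) (a (Ψ z)) z.1 := hsub hzs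
    have h2 : HasFDerivAt (fun y => (ψ.symm y).2) (fderiv ℝ (fun y => (ψ.symm y).2) y)
        (Ψ (z.1, z.2)) := by
      rw [Prod.mk.eta, hΨz]
      exact ((hus y hy).differentiableAt h0).hasFDerivAt
    have h3 := h2.comp_hasDerivAt z.1 h1
    have h4 : (fun _ => z.2) =ᶠ[𝓝 z.1] (fun y => (ψ.symm y).2) ∘ fun t => Ψ (t, z.2) := by
      have h5 : ContinuousAt (fun t : ℝ => (t, z.2)) z.1 := by fun_prop
      filter_upwards [h5.preimage_mem_nhds (ψ.open_source.mem_nhds hzs)] with t ht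
      simp only [Function.comp_apply]
      rw [hinvl _ ht]
    rw [hΨz] at h3
    exact h3.unique ((hasDerivAt_const z.1 z.2).congr_of_eventuallyEq h4.symm)
  · have h1 : HasFDerivAt (fun y => (ψ.symm y).2) (fderiv ℝ (fun y => (ψ.symm y).2) y₀)
        (Ψ (0, 0)) := by
      rw [hΨ0]; exact ((hus y₀ hy₀t).differentiableAt h0).hasFDerivAt
    have h2 := h1.comp (0, 0) hd0
    have h3 : (Prod.snd : ℝ × ℝ → ℝ) =ᶠ[𝓝 (0, 0)] (fun y => (ψ.symm y).2) ∘ Ψ := by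
      filter_upwards [ψ.open_source.mem_nhds h0ψ] with z hz
      simp only [Function.comp_apply]
      rw [hinvl _ hz]
    have h4 := h2.unique (hasFDerivAt_snd.congr_of_eventuallyEq h3.symm)
    have h5 := DFunLike.congr_fun h4 ((0 : ℝ), (1 : ℝ))
    simpa [h01] using h5

/-! ### Hamiltonian flows -/

/-- The Hamiltonian vector field `(∂H/∂p, -∂H/∂x)`. -/
noncomputable def hamiltonianField (H : Plane → Plane → ℝ) (z : Plane × Plane) : Plane × Plane :=
  (WithLp.toLp 2 fun i => fderiv ℝ (fun p => H z.1 p) z.2 (stdVec i),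
    -WithLp.toLp 2 fun i => fderiv ℝ (fun x => H x z.2) z.1 (stdVec i))

section Slices

variable {F : Plane → Plane → ℝ} {z : Plane × Plane}

lemma fderiv_slice_left (hF : DifferentiableAt ℝ (fun w : Plane × Plane => F w.1 w.2) z)
    (v : Plane) : fderiv ℝ (fun x => F x z.2) z.1 v =
      fderiv ℝ (fun w : Plane × Plane => F w.1 w.2) z (v, 0) := by
  have := HasFDerivAt.comp (f := fun x => (x, z.2)) z.1 hF.hasFDerivAt
    (hasFDerivAt_prodMk_left z.1 z.2)
  rw [HasFDerivAt.fderiv (f := fun x => F x z.2) this]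
  simp

lemma fderiv_slice_right (hF : DifferentiableAt ℝ (fun w : Plane × Plane => F w.1 w.2) z)
    (v : Plane) : fderiv ℝ (fun p => F z.1 p) z.2 v =
      fderiv ℝ (fun w : Plane × Plane => F w.1 w.2) z (0, v) := by
  have := HasFDerivAt.comp (f := fun p => (z.1, p)) z.2 hF.hasFDerivAt
    (hasFDerivAt_prodMk_right z.1 z.2)
  rw [HasFDerivAt.fderiv (f := fun p => F z.1 p) this]
  simp

end Slices

lemma plane_eq_sum (v : Plane) : v = v 0 • stdVec 0 + v 1 • stdVec 1 := by
  ext i; fin_cases i <;> simp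

/-- The Poisson bracket `{F, H}` is the derivative of `F` along the Hamiltonian field of `H`. -/
lemma fderiv_hamiltonianField {F H : Plane → Plane → ℝ} {z : Plane × Plane}
    (hF : DifferentiableAt ℝ (fun w : Plane × Plane => F w.1 w.2) z) :
    fderiv ℝ (fun w : Plane × Plane => F w.1 w.2) z (hamiltonianField H z) =
      poisson F H z.1 z.2 := by
  have h1 : hamiltonianField H z = ((hamiltonianField H z).1, 0) + (0, (hamiltonianField H z).2) := by
    simp
  rw [h1, map_add, ← fderiv_slice_left hF, ← fderiv_slice_right hF,
    plane_eq_sum (hamiltonianField H z).1, plane_eq_sum (hamiltonianField H z).2]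
  simp only [map_add, map_smul, poisson, Fin.sum_univ_two, hamiltonianField, smul_eq_mul,
    PiLp.neg_apply]
  ring

lemma contDiffOn_hamiltonianField {H : Plane → Plane → ℝ} {T : Set Plane} (hT : IsOpen T)
    (hH : ContDiffOn ℝ ∞ (fun w : Plane × Plane => H w.1 w.2) (T ×ˢ univ)) :
    ContDiffOn ℝ ∞ (hamiltonianField H) (T ×ˢ univ) := by
  have hTo : IsOpen (T ×ˢ (univ : Set Plane)) := hT.prod isOpen_univ
  have hd := hH.fderiv_of_isOpen hTo (m := ∞) (by simp)
  have hdiff : ∀ z ∈ T ×ˢ (univ : Set Plane),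
      DifferentiableAt ℝ (fun w : Plane × Plane => H w.1 w.2) z := fun z hz =>
    (hH.contDiffAt (hTo.mem_nhds hz)).differentiableAt (by simp)
  refine ContDiffOn.prodMk ?_ (ContDiffOn.neg ?_)
  · rw [contDiffOn_euclidean]
    intro i
    refine (hd.clm_apply (contDiffOn_const (c := ((0 : Plane), stdVec i)))).congr fun z hz => ?_
    exact fderiv_slice_right (hdiff z hz) _
  · rw [contDiffOn_euclidean]
    intro i
    refine (hd.clm_apply (contDiffOn_const (c := (stdVec i, (0 : Plane))))).congr fun z hz => ?_
    exact fderiv_slice_left (hdiff z hz) _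

/-- The local Hamiltonian flow of `H` preserves every function that Poisson commutes with `H`. -/
theorem exists_hamiltonianFlow {F H : Plane → Plane → ℝ} {T : Set Plane} (hT : IsOpen T)
    (hF : ContDiffOn ℝ ∞ (fun w : Plane × Plane => F w.1 w.2) (T ×ˢ univ))
    (hH : ContDiffOn ℝ ∞ (fun w : Plane × Plane => H w.1 w.2) (T ×ˢ univ))
    (hFH : ∀ x ∈ T, ∀ p, poisson F H x p = 0) {x₀ : Plane} (hx₀ : x₀ ∈ T) (p₀ : Plane) :
    ∃ φ : ℝ × (Plane × Plane) → Plane × Plane, φ (0, (x₀, p₀)) = (x₀, p₀) ∧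
      ∀ᶠ w in 𝓝 ((0 : ℝ), (x₀, p₀)), ContinuousAt φ w ∧ F (φ w).1 (φ w).2 = F w.2.1 w.2.2 ∧
        HasDerivAt (fun t => φ (t, w.2)) (hamiltonianField H (φ w)) w.1 := by
  have hTo : IsOpen (T ×ˢ (univ : Set Plane)) := hT.prod isOpen_univ
  obtain ⟨φ, hφ0, hφ⟩ := exists_smooth_localFlow hTo (contDiffOn_hamiltonianField hT hH)
    (x₀ := (x₀, p₀)) ⟨hx₀, mem_univ _⟩
  refine ⟨φ, hφ0.self_of_nhds, ?_⟩
  have hφ0' : ∀ᶠ w in 𝓝 ((0 : ℝ), (x₀, p₀)), φ (0, w.2) = w.2 :=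
    (continuousAt_snd (p := ((0 : ℝ), (x₀, p₀)))).eventually hφ0
  obtain ⟨r, hr, hball⟩ := Metric.eventually_nhds_iff_ball.1 (hφ.and hφ0')
  filter_upwards [Metric.ball_mem_nhds _ hr] with w hw
  obtain ⟨t, z⟩ := w
  refine ⟨(hball _ hw).1.1.continuousAt, ?_, (hball _ hw).1.2.2⟩
  simp only [Metric.mem_ball, Prod.dist_eq (x := (t, z)), max_lt_iff] at hw
  have hmem : ∀ s ∈ Metric.ball (0 : ℝ) r, (s, z) ∈ Metric.ball ((0 : ℝ), (x₀, p₀)) r := by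
    intro s hs
    simp only [Metric.mem_ball, Prod.dist_eq (x := (s, z)), max_lt_iff]
    exact ⟨hs, hw.2⟩
  have hderiv : ∀ s ∈ Metric.ball (0 : ℝ) r,
      HasDerivAt (fun t => F (φ (t, z)).1 (φ (t, z)).2) 0 s := by
    intro s hs
    obtain ⟨⟨-, h2, h3⟩, -⟩ := hball _ (hmem s hs)
    have h4 : DifferentiableAt ℝ (fun w : Plane × Plane => F w.1 w.2) (φ (s, z)) :=
      (hF.contDiffAt (hTo.mem_nhds h2)).differentiableAt (by simp)
    have h5 := h4.hasFDerivAt.comp_hasDerivAt s h3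
    rw [fderiv_hamiltonianField h4, hFH _ h2.1] at h5
    exact h5
  have h0 : (0 : ℝ) ∈ Metric.ball (0 : ℝ) r := Metric.mem_ball_self hr
  have hconst := Metric.isOpen_ball.is_const_of_deriv_eq_zero
    (convex_ball (0 : ℝ) r).isPreconnected
    (fun s hs => (hderiv s hs).differentiableAt.differentiableWithinAt)
    (fun s hs => (hderiv s hs).deriv) hw.1 h0
  have h6 := (hball _ (hmem 0 h0)).2
  simp only at hconst h6
  rw [hconst, h6]

/-! ### Products of linear forms as integrals of quadratic Hamiltonians -/

/-- The product of linear forms `∏ₘ (a¹ₘ(x) p₁ + a²ₘ(x) p₂)`. -/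
noncomputable def linearProd {N : ℕ} (a : Fin N → Plane → Plane) (x p : Plane) : ℝ :=
  ∏ m, ∑ k, p k * a m x k

/-- The Hamiltonian `½ ∑ G^{km}(x) p_k p_m`. -/
noncomputable def quadHamiltonian (G : Plane → Matrix (Fin 2) (Fin 2) ℝ) (x p : Plane) : ℝ :=
  (1 / 2) * ∑ k, ∑ m, G x k m * p k * p m

section LinearProd

variable {N : ℕ} {a : Fin N → Plane → Plane} {T : Set Plane}

lemma contDiffOn_linearProd (ha : ∀ m, ContDiffOn ℝ ∞ (a m) T) :
    ContDiffOn ℝ ∞ (fun w : Plane × Plane => linearProd a w.1 w.2) (T ×ˢ univ) := by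
  unfold linearProd
  refine contDiffOn_prod fun m _ => ContDiffOn.sum fun k _ => ContDiffOn.mul ?_ ?_
  · exact ((EuclideanSpace.proj k : Plane →L[ℝ] ℝ).contDiff.comp contDiff_snd).contDiffOn
  · exact ((EuclideanSpace.proj k : Plane →L[ℝ] ℝ).contDiff.comp_contDiffOn (ha m)).comp
      contDiffOn_fst fun w hw => hw.1

lemma linearForm_zero {v : Plane} (h : ∀ p : Plane, ∑ k, p k * v k = 0) : v = 0 := by
  ext k
  simpa using h (stdVec k)

/-- A product of linear forms that vanishes on a nonempty open set has a vanishing factor. -/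
lemma exists_eq_zero_of_eventually_linearProd {x p₀ : Plane}
    (h : ∀ᶠ p in 𝓝 p₀, linearProd a x p = 0) : ∃ m, a m x = 0 := by
  by_contra! hne
  let ℓ : Fin N → Plane →ₗ[ℝ] ℝ := fun m =>
    { toFun := fun p => ∑ k, p k * a m x k
      map_add' := fun p q => by simp [add_mul, Finset.sum_add_distrib]
      map_smul' := fun c p => by simp [mul_assoc, mul_add] }
  have hopen : ∀ m, IsOpen {p : Plane | ℓ m p ≠ 0} := fun m =>
    isOpen_ne.preimage (ℓ m).continuous_of_finiteDimensional
  have hdense : ∀ m, Dense {p : Plane | ℓ m p ≠ 0} := by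
    intro m
    have hker : interior ((LinearMap.ker (ℓ m) : Submodule ℝ Plane) : Set Plane) = ∅ := by
      by_contra hint
      have htop := Submodule.eq_top_of_nonempty_interior' _ (nonempty_iff_ne_empty.2 hint)
      refine hne m (linearForm_zero fun p => ?_)
      have : p ∈ LinearMap.ker (ℓ m) := htop ▸ Submodule.mem_top
      exact LinearMap.mem_ker.1 this
    exact interior_eq_empty_iff_dense_compl.1 hker
  have hd : Dense (⋂ m, {p : Plane | ℓ m p ≠ 0}) := dense_iInter_of_isOpen hopen hdense
  obtain ⟨s, hs, hso, hps⟩ := eventually_nhds_iff.1 h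
  obtain ⟨p, hps', hp⟩ := hd.exists_mem_open hso ⟨p₀, hps⟩
  exact (Finset.prod_ne_zero_iff.2 fun m _ => (mem_iInter.1 hps' m :)) (hs p hp)

lemma linearProd_eq_zero {x : Plane} {m : Fin N} (h : a m x = 0) (p : Plane) :
    linearProd a x p = 0 :=
  Finset.prod_eq_zero (Finset.mem_univ m) (by simp [h])

end LinearProd

section QuadHamiltonian

variable {G : Plane → Matrix (Fin 2) (Fin 2) ℝ} {T : Set Plane}

lemma contDiffOn_quadHamiltonian (hG : ∀ k m, ContDiffOn ℝ ∞ (fun x => G x k m) T) :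
    ContDiffOn ℝ ∞ (fun w : Plane × Plane => quadHamiltonian G w.1 w.2) (T ×ˢ univ) := by
  have hp : ∀ k, ContDiffOn ℝ ∞ (fun w : Plane × Plane => w.2 k) (T ×ˢ univ) := fun k =>
    ((EuclideanSpace.proj k : Plane →L[ℝ] ℝ).contDiff.comp contDiff_snd).contDiffOn
  unfold quadHamiltonian
  refine contDiffOn_const.mul (ContDiffOn.sum fun k _ => ContDiffOn.sum fun m _ =>
    ContDiffOn.mul (ContDiffOn.mul ?_ (hp k)) (hp m))
  exact (hG k m).comp contDiffOn_fst fun w hw => hw.1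

lemma quadHamiltonian_eq (x p : Plane) : quadHamiltonian G x p =
    (1 / 2) * G x 0 0 * p 0 ^ 2 + (1 / 2) * (G x 0 1 + G x 1 0) * p 0 * p 1
      + (1 / 2) * G x 1 1 * p 1 ^ 2 := by
  simp only [quadHamiltonian, Fin.sum_univ_two]; ring

/-- The velocity of the Hamiltonian flow of a quadratic Hamiltonian is `G(x) p`. -/
lemma hamiltonianField_quadHamiltonian_fst (hsymm : ∀ x, (G x).IsSymm) (z : Plane × Plane)
    (i : Fin 2) : (hamiltonianField (quadHamiltonian G) z).1 i = ∑ k, G z.1 i k * z.2 k := by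
  have h01 : G z.1 1 0 = G z.1 0 1 := (hsymm z.1).apply 0 1
  have hp : ∀ k : Fin 2, HasFDerivAt (fun p : Plane => p k)
      (EuclideanSpace.proj k : Plane →L[ℝ] ℝ) z.2 := fun k =>
    (EuclideanSpace.proj k : Plane →L[ℝ] ℝ).hasFDerivAt
  have h := ((((hp 0).pow 2).const_mul ((1 / 2) * G z.1 0 0)).add
    (((hp 0).mul (hp 1)).const_mul ((1 / 2) * (G z.1 0 1 + G z.1 1 0)))).add
    (((hp 1).pow 2).const_mul ((1 / 2) * G z.1 1 1))
  have h' := h.congr_of_eventuallyEq (f₁ := fun p => quadHamiltonian G z.1 p)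
    (Eventually.of_forall fun p => by
      simp only [quadHamiltonian_eq, Pi.add_apply, Pi.mul_apply]; ring)
  simp only [hamiltonianField, h'.fderiv, Fin.sum_univ_two, h01]
  fin_cases i <;> simp [h01] <;> ring

/-- Along the covector `dxˡ` the Hamiltonian is `½ G^{ll}`. -/
lemma hamiltonianField_quadHamiltonian_snd (x : Plane) (k l : Fin 2)
    (hd : DifferentiableAt ℝ (fun x => G x l l) x) :
    (hamiltonianField (quadHamiltonian G) (x, stdVec l)).2 k =
      -((1 / 2) * fderiv ℝ (fun x => G x l l) x (stdVec k)) := by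
  have h := (hd.hasFDerivAt.const_mul (1 / 2)).congr_of_eventuallyEq
    (f₁ := fun x => quadHamiltonian G x (stdVec l))
    (Eventually.of_forall fun x => by
      simp only [quadHamiltonian_eq]
      fin_cases l <;> simp)
  simp only [hamiltonianField, h.fderiv, PiLp.neg_apply]
  simp

end QuadHamiltonian

section Integral

variable {N : ℕ} {a : Fin N → Plane → Plane} {G : Plane → Matrix (Fin 2) (Fin 2) ℝ}
  {T : Set Plane}

/-- If the integral vanishes on the fibres over a ball then it vanishes on the fibres near every
boundary point of this ball: the trajectory issuing from the boundary point towards the centre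
enters the ball at once, and so do all neighbouring trajectories. -/
lemma eventually_exists_eq_zero_of_ball (hT : IsOpen T) (ha : ∀ m, ContDiffOn ℝ ∞ (a m) T)
    (hG : ∀ k m, ContDiffOn ℝ ∞ (fun x => G x k m) T) (hsymm : ∀ x, (G x).IsSymm)
    (hdet : ∀ x ∈ T, (G x).det ≠ 0)
    (hint : ∀ x ∈ T, ∀ p, poisson (linearProd a) (quadHamiltonian G) x p = 0)
    {q z : Plane} (hq : q ∈ T) (hqz : q ≠ z)
    (hball : ∀ x ∈ Metric.ball z (dist q z), ∃ m, a m x = 0) :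
    ∀ᶠ x in 𝓝 q, ∃ m, a m x = 0 := by
  -- the covector whose velocity points from `q` to `z`
  set p₀ : Plane := WithLp.toLp 2 ((G q)⁻¹.mulVec (z - q).ofLp) with hp₀
  obtain ⟨φ, hφ0, hφ⟩ := exists_hamiltonianFlow hT (contDiffOn_linearProd ha)
    (contDiffOn_quadHamiltonian hG) hint hq p₀
  have hvel : (hamiltonianField (quadHamiltonian G) (q, p₀)).1 = z - q := by
    ext i
    rw [hamiltonianField_quadHamiltonian_fst hsymm]
    have : (G q).mulVec ((G q)⁻¹.mulVec (z - q).ofLp) = (z - q).ofLp := by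
      rw [Matrix.mulVec_mulVec, Matrix.mul_nonsing_inv _ (hdet q hq).isUnit, Matrix.one_mulVec]
    exact congrFun this i
  have hd : HasDerivAt (fun t => φ (t, (q, p₀))) (hamiltonianField (quadHamiltonian G) (q, p₀))
      0 := by
    have := hφ.self_of_nhds.2.2
    rwa [hφ0] at this
  have hdx : HasDerivAt (fun t => (φ (t, (q, p₀))).1) (z - q) 0 := by
    have := (hasFDerivAt_fst (𝕜 := ℝ) (p := φ (0, (q, p₀)))).comp_hasDerivAt (0 : ℝ) hd
    rw [ContinuousLinearMap.coe_fst'] at this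
    rwa [hvel] at this
  have hnorm : HasDerivAt (fun t => ‖(φ (t, (q, p₀))).1 - z‖ ^ 2)
      (2 * inner ℝ (q - z) (z - q)) 0 := by
    have := (hdx.sub_const z).norm_sq
    simpa only [hφ0] using this
  have hneg : 2 * inner ℝ (q - z) (z - q) < 0 := by
    have h1 : z - q = -(q - z) := by abel
    rw [h1, inner_neg_right, real_inner_self_eq_norm_sq]
    have : 0 < ‖q - z‖ := norm_pos_iff.2 (sub_ne_zero.2 hqz)
    nlinarith [pow_pos this 2]
  have henter : ∀ᶠ t in 𝓝[>] (0 : ℝ), (φ (t, (q, p₀))).1 ∈ Metric.ball z (dist q z) := by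
    have h1 := (hasDerivWithinAt_iff_tendsto_slope' (s := Ioi (0 : ℝ)) (by simp)).1
      hnorm.hasDerivWithinAt
    filter_upwards [h1.eventually (gt_mem_nhds hneg), self_mem_nhdsWithin] with t ht ht0
    rw [slope_def_field, hφ0, sub_zero, div_lt_iff₀ (mem_Ioi.1 ht0), zero_mul, sub_neg] at ht
    rw [Metric.mem_ball, dist_eq_norm, dist_eq_norm]
    exact lt_of_pow_lt_pow_left₀ 2 (norm_nonneg _) ht
  have hgood : ∀ᶠ t in 𝓝[>] (0 : ℝ), ∀ᶠ w in 𝓝 (q, p₀), ContinuousAt φ (t, w) ∧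
      linearProd a (φ (t, w)).1 (φ (t, w)).2 = linearProd a w.1 w.2 := by
    have h1 := hφ.eventually_nhds
    have h2 : Tendsto (fun t : ℝ => (t, (q, p₀))) (𝓝[>] 0) (𝓝 (0, (q, p₀))) := by
      have : Continuous fun t : ℝ => (t, (q, p₀)) := by fun_prop
      exact (this.tendsto 0).mono_left nhdsWithin_le_nhds
    filter_upwards [h2.eventually h1] with t ht
    have h3 : Tendsto (fun w : Plane × Plane => (t, w)) (𝓝 (q, p₀)) (𝓝 (t, (q, p₀))) := by
      have : Continuous fun w : Plane × Plane => (t, w) := by fun_prop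
      exact this.tendsto _
    filter_upwards [h3.eventually ht] with w hw
    exact ⟨hw.1, hw.2.1⟩
  obtain ⟨t, ht1, ht2⟩ := (henter.and hgood).exists
  have hzero : ∀ᶠ w in 𝓝 (q, p₀), linearProd a w.1 w.2 = 0 := by
    have hc : ContinuousAt (fun w : Plane × Plane => (φ (t, w)).1) (q, p₀) :=
      continuousAt_fst.comp
        (ContinuousAt.comp (f := fun w : Plane × Plane => (t, w)) ht2.self_of_nhds.1
          (by fun_prop))
    filter_upwards [ht2, hc.preimage_mem_nhds (Metric.isOpen_ball.mem_nhds ht1)] with w h1 h2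
    obtain ⟨m, hm⟩ := hball _ h2
    rw [← h1.2, linearProd_eq_zero hm]
  rw [nhds_prod_eq] at hzero
  filter_upwards [hzero.curry] with x hx
  exact exists_eq_zero_of_eventually_linearProd hx

/-- **Unique continuation**: if the integral does not vanish identically near `x₀`, then it does
not vanish identically near any point of a neighbourhood of `x₀`. -/
theorem eventually_frequently_ne_zero (hT : IsOpen T) (ha : ∀ m, ContDiffOn ℝ ∞ (a m) T)
    (hG : ∀ k m, ContDiffOn ℝ ∞ (fun x => G x k m) T) (hsymm : ∀ x, (G x).IsSymm)
    (hdet : ∀ x ∈ T, (G x).det ≠ 0)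
    (hint : ∀ x ∈ T, ∀ p, poisson (linearProd a) (quadHamiltonian G) x p = 0)
    {x₀ : Plane} (hx₀ : x₀ ∈ T) (hne : ∃ᶠ x in 𝓝 x₀, ∀ m, a m x ≠ 0) :
    ∀ᶠ x in 𝓝 x₀, ∃ᶠ y in 𝓝 x, ∀ m, a m y ≠ 0 := by
  obtain ⟨r, hr, hrT⟩ := Metric.isOpen_iff.1 hT x₀ hx₀
  filter_upwards [Metric.ball_mem_nhds x₀ hr] with x hx hcon
  set O : Set Plane := interior {y | ∃ m, a m y = 0} with hO
  have hxO : x ∈ O := by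
    rw [hO, mem_interior_iff_mem_nhds]
    filter_upwards [hcon] with y hy
    push Not at hy
    exact hy
  -- the zero set is relatively closed in the ball, by the interior ball argument
  have hclosed : closure O ∩ Metric.ball x₀ r ⊆ O := by
    rintro y ⟨hyO, hyB⟩
    by_contra hy
    obtain ⟨δ, hδ, hδB⟩ := Metric.isOpen_iff.1 Metric.isOpen_ball y hyB
    obtain ⟨z, hzO, hyz⟩ := Metric.mem_closure_iff.1 hyO (δ / 2) (by positivity)
    have hclc : IsClosed Oᶜ := isOpen_interior.isClosed_compl
    obtain ⟨q, hqO, hqz⟩ := hclc.exists_infDist_eq_dist ⟨y, hy⟩ z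
    have hqy : dist z q ≤ dist z y := hqz ▸ Metric.infDist_le_dist_of_mem hy
    have hqT : q ∈ T := hrT (hδB (by
      rw [Metric.mem_ball]
      have := dist_triangle q z y
      rw [dist_comm q z, dist_comm y z] at *
      linarith))
    refine hqO ?_
    rw [hO, mem_interior_iff_mem_nhds]
    refine eventually_exists_eq_zero_of_ball hT ha hG hsymm hdet hint hqT
      (fun h => hqO (h ▸ hzO)) fun w hw => ?_
    have hwO : w ∈ O := by
      by_contra hwO
      have := Metric.infDist_le_dist_of_mem (x := z) (show w ∈ Oᶜ from hwO)
      rw [Metric.mem_ball, dist_comm w z, dist_comm q z] at hw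
      linarith
    exact interior_subset (s := {y | ∃ m, a m y = 0}) hwO
  have hsub := (convex_ball x₀ r).isPreconnected.subset_of_closure_inter_subset isOpen_interior
    ⟨x, hx, hxO⟩ hclosed
  have hx₀O : x₀ ∈ O := hsub (Metric.mem_ball_self hr)
  refine hne ?_
  filter_upwards [mem_interior_iff_mem_nhds.1 hx₀O] with y ⟨m, hm⟩ h
  exact h m hm

/-- For finitely many continuous functions, every nonempty open set contains a point near which
each of them is either nonzero or identically zero. -/
lemma exists_forall_ne_or_eventually_eq {X ι : Type*} [TopologicalSpace X] [Finite ι]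
    {f : ι → X → ℝ} {U : Set X} (hU : IsOpen U) (hUne : U.Nonempty)
    (hf : ∀ i, ContinuousOn (f i) U) :
    ∃ x ∈ U, ∀ i, f i x ≠ 0 ∨ ∀ᶠ y in 𝓝 x, f i y = 0 := by
  have key : ∀ s : Set ι, s.Finite → ∃ V ⊆ U, IsOpen V ∧ V.Nonempty ∧
      ∀ i ∈ s, (∀ x ∈ V, f i x ≠ 0) ∨ ∀ x ∈ V, f i x = 0 := by
    intro s hs
    induction s, hs using Set.Finite.induction_on with
    | empty => exact ⟨U, subset_rfl, hU, hUne, by simp⟩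
    | @insert i s _ _ ih =>
      obtain ⟨V, hVU, hV, hVne, h⟩ := ih
      by_cases h0 : ∀ x ∈ V, f i x = 0
      · refine ⟨V, hVU, hV, hVne, ?_⟩
        rintro j (rfl | hj)
        · exact Or.inr h0
        · exact h j hj
      · push Not at h0
        obtain ⟨x, hx, hfx⟩ := h0
        refine ⟨V ∩ f i ⁻¹' {0}ᶜ, inter_subset_left.trans hVU,
          ((hf i).mono hVU).isOpen_inter_preimage hV isOpen_compl_singleton, ⟨x, hx, hfx⟩, ?_⟩
        rintro j (rfl | hj)
        · exact Or.inl fun y hy => hy.2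
        · exact (h j hj).imp (fun h y hy => h y hy.1) fun h y hy => h y hy.1
  obtain ⟨V, hVU, hV, ⟨x, hx⟩, h⟩ := key univ finite_univ
  exact ⟨x, hVU hx, fun i => (h i (mem_univ i)).imp (fun h => h x hx)
    fun h => by filter_upwards [hV.mem_nhds hx] with y hy using h y hy⟩

/-- If one factor of the integral is proportional to `p_k`, then `G^{ll}` with `l ≠ k` does not
depend on `x^k`. Near a generic point the zero set of the integral around the covector `dxˡ` is
`p_k = 0`, so the trajectory starting there keeps `p_k = 0`. -/
theorem fderiv_diagonal_eq_zero (hT : IsOpen T) (ha : ∀ m, ContDiffOn ℝ ∞ (a m) T)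
    (hG : ∀ k m, ContDiffOn ℝ ∞ (fun x => G x k m) T)
    (hint : ∀ x ∈ T, ∀ p, poisson (linearProd a) (quadHamiltonian G) x p = 0)
    (hne : ∀ x ∈ T, ∃ᶠ y in 𝓝 x, ∀ m, a m y ≠ 0) {k l : Fin 2} (hkl : k ≠ l) {i : Fin N}
    (hi : ∀ x ∈ T, a i x l = 0) {x₀ : Plane} (hx₀ : x₀ ∈ T) :
    fderiv ℝ (fun x => G x l l) x₀ (stdVec k) = 0 := by
  have hsum : ∀ p v : Plane, ∑ j, p j * v j = p k * v k + p l * v l := by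
    intro p v
    rw [Fin.sum_univ_two]
    fin_cases k <;> fin_cases l <;> simp_all [add_comm]
  by_contra hD
  set D : Plane → ℝ := fun x => fderiv ℝ (fun x => G x l l) x (stdVec k) with hDdef
  have hDc : ContinuousOn D T :=
    ((hG l l).continuousOn_fderiv_of_isOpen hT (by simp)).clm_apply continuousOn_const
  have hac : ∀ m j, ContinuousOn (fun x => a m x j) T := fun m j =>
    (EuclideanSpace.proj j : Plane →L[ℝ] ℝ).continuous.comp_continuousOn (ha m).continuousOn
  -- the open set where `D ≠ 0` and the integral is nonzero on the fibre
  set U : Set Plane := (T ∩ D ⁻¹' {0}ᶜ) ∩ ⋂ m, (T ∩ a m ⁻¹' {0}ᶜ) with hU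
  have hTD : IsOpen (T ∩ D ⁻¹' {0}ᶜ) := hDc.isOpen_inter_preimage hT isOpen_compl_singleton
  have hUo : IsOpen U := hTD.inter (isOpen_iInter_of_finite fun m =>
    (ha m).continuousOn.isOpen_inter_preimage hT isOpen_compl_singleton)
  have hUne : U.Nonempty := by
    obtain ⟨y, hy1, hy2⟩ := ((hne x₀ hx₀).and_eventually (hTD.mem_nhds ⟨hx₀, hD⟩)).exists
    exact ⟨y, hy2, mem_iInter.2 fun m => ⟨hy2.1, hy1 m⟩⟩
  obtain ⟨x, hxU, hx⟩ := exists_forall_ne_or_eventually_eq (f := fun m x => a m x l) hUo hUne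
    fun m => (hac m l).mono fun y hy => hy.1.1
  have hxT : x ∈ T := hxU.1.1
  have hax : ∀ m, a m x ≠ 0 := fun m => (mem_iInter.1 hxU.2 m).2
  set e : Plane := stdVec l with he
  have hek : e k = 0 := by simp [he, hkl]
  have hel : e l = 1 := by simp [he]
  -- the zero set of the integral near the covector `dxˡ` at `x`
  have hzero : ∀ᶠ w in 𝓝 (x, e), linearProd a w.1 w.2 = 0 → w.2 k = 0 := by
    have hcoef : ∀ m, ∀ᶠ w in 𝓝 (x, e), ∑ j, w.2 j * a m w.1 j = 0 → w.2 k = 0 := by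
      intro m
      have hc : ∀ j, ContinuousAt (fun w : Plane × Plane => a m w.1 j) (x, e) := fun j =>
        ContinuousAt.comp (f := Prod.fst) (g := fun y => a m y j)
          ((hac m j).continuousAt (hT.mem_nhds hxT)) continuousAt_fst
      have hp : ∀ j, ContinuousAt (fun w : Plane × Plane => w.2 j) (x, e) := fun j =>
        ((EuclideanSpace.proj j : Plane →L[ℝ] ℝ).continuous.comp continuous_snd).continuousAt
      simp only [hsum]
      rcases hx m with h | h
      · have h1 : ContinuousAt (fun w : Plane × Plane =>
            w.2 k * a m w.1 k + w.2 l * a m w.1 l) (x, e) :=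
          ((hp k).mul (hc k)).add ((hp l).mul (hc l))
        have h2 : (fun w : Plane × Plane => w.2 k * a m w.1 k + w.2 l * a m w.1 l) (x, e) ≠ 0 := by
          simpa [hek, hel] using h
        filter_upwards [h1.eventually_ne h2] with w hw h0
        exact absurd h0 hw
      · have h1 : a m x k ≠ 0 := by
          intro h0
          refine hax m (linearForm_zero fun p => ?_)
          have hl : a m x l = 0 := h.self_of_nhds
          rw [hsum, h0, hl, mul_zero, mul_zero, add_zero]
        filter_upwards [(hc k).eventually_ne h1, continuousAt_fst.eventually h] with w hw1 hw2 h0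
        rw [hw2, mul_zero, add_zero] at h0
        exact (mul_eq_zero.1 h0).resolve_right hw1
    filter_upwards [eventually_all.2 hcoef] with w hw h0
    obtain ⟨m, -, hm⟩ := Finset.prod_eq_zero_iff.1 h0
    exact hw m hm
  obtain ⟨φ, hφ0, hφ⟩ := exists_hamiltonianFlow hT (contDiffOn_linearProd ha)
    (contDiffOn_quadHamiltonian hG) hint hxT e
  have hstart : linearProd a x e = 0 := by
    refine Finset.prod_eq_zero (Finset.mem_univ i) ?_
    rw [hsum, hek, hi x hxT, zero_mul, mul_zero, add_zero]
  have hline : Tendsto (fun t : ℝ => (t, (x, e))) (𝓝 0) (𝓝 (0, (x, e))) := by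
    have : Continuous fun t : ℝ => (t, (x, e)) := by fun_prop
    exact this.tendsto 0
  have hd : HasDerivAt (fun t => φ (t, (x, e))) (hamiltonianField (quadHamiltonian G) (x, e))
      0 := by
    have := hφ.self_of_nhds.2.2
    rwa [hφ0] at this
  have hpk : (fun t => (φ (t, (x, e))).2 k) =ᶠ[𝓝 0] fun _ => 0 := by
    have h1 : Tendsto (fun t => φ (t, (x, e))) (𝓝 0) (𝓝 (x, e)) := by
      have := hd.continuousAt
      rwa [ContinuousAt, hφ0] at this
    filter_upwards [h1.eventually hzero, hline.eventually hφ] with t ht1 ht2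
    exact ht1 (ht2.2.1.trans hstart)
  have hdk := (EuclideanSpace.proj k : Plane →L[ℝ] ℝ).hasFDerivAt.comp_hasDerivAt (0 : ℝ) hd.snd
  have h0 : (hamiltonianField (quadHamiltonian G) (x, e)).2 k = 0 :=
    hdk.unique ((hasDerivAt_const (0 : ℝ) (0 : ℝ)).congr_of_eventuallyEq hpk)
  rw [he, hamiltonianField_quadHamiltonian_snd x k l
    (((hG l l).contDiffAt (hT.mem_nhds hxT)).differentiableAt (by simp))] at h0
  refine hxU.1.2 ?_
  simp only [mem_singleton_iff, hDdef]
  linarith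

end Integral

/-! ### Coordinate expressions of fields and metrics -/

section Coordinates

variable {M : Type*} [TopologicalSpace M] [ChartedSpace Plane M] [IsManifold (𝓡 2) ∞ M]

/-- The components `(α¹, α²)` of a vector field in the chart `e`. -/
noncomputable def fieldCoord (e : OpenPartialHomeomorph M Plane) (X : SmoothField M)
    (y : Plane) : Plane :=
  mfderiv (𝓡 2) (𝓡 2) e (e.symm y) (X.toFun (e.symm y))

/-- The components at a point `z`, without the detour through `e.symm (e z) = z`, which changes the
type of the tangent vector. -/
lemma fieldCoord_apply {e : OpenPartialHomeomorph M Plane} {z : M} (hz : z ∈ e.source)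
    (X : SmoothField M) : fieldCoord e X (e z) = mfderiv (𝓡 2) (𝓡 2) e z (X.toFun z) := by
  have h : ∀ w, w = z → (mfderiv (𝓡 2) (𝓡 2) e w (X.toFun w) : Plane) =
      mfderiv (𝓡 2) (𝓡 2) e z (X.toFun z) := by
    rintro _ rfl
    rfl
  exact h _ (e.left_inv hz)

lemma factorizedCoord_eq {N : ℕ} (X : Fin N → SmoothField M)
    (e : OpenPartialHomeomorph M Plane) :
    factorizedCoord X e = linearProd fun m => fieldCoord e (X m) := by
  funext y p
  simp only [factorizedCoord, factorized, linearProd, coordCovec]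
  refine Finset.prod_congr rfl fun m _ => ?_
  rw [_root_.sum_apply]
  rfl

lemma hamiltonian_eq (g : PseudoMetric M) (e : OpenPartialHomeomorph M Plane) :
    g.hamiltonian e = quadHamiltonian fun y => (g.coeff e y)⁻¹ := rfl

variable {e : OpenPartialHomeomorph M Plane}

omit [IsManifold (𝓡 2) ∞ M] in
lemma mdifferentiable_of_mem_maximalAtlas (he : e ∈ IsManifold.maximalAtlas (𝓡 2) ∞ M) :
    e.MDifferentiable (𝓡 2) (𝓡 2) :=
  ⟨(contMDiffOn_of_mem_maximalAtlas he).mdifferentiableOn (by simp),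
    (contMDiffOn_symm_of_mem_maximalAtlas he).mdifferentiableOn (by simp)⟩

omit [IsManifold (𝓡 2) ∞ M] in
lemma mfderiv_coordVec (he : e ∈ IsManifold.maximalAtlas (𝓡 2) ∞ M) {y : Plane}
    (hy : y ∈ e.target) (k : Fin 2) :
    mfderiv (𝓡 2) (𝓡 2) e (e.symm y) (coordVec e y k) = stdVec k :=
  DFunLike.congr_fun ((mdifferentiable_of_mem_maximalAtlas he).comp_symm_deriv hy) (stdVec k)

omit [IsManifold (𝓡 2) ∞ M] in
/-- Expansion of a tangent vector in the coordinate frame. -/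
lemma eq_sum_coordVec (he : e ∈ IsManifold.maximalAtlas (𝓡 2) ∞ M) {y : Plane}
    (hy : y ∈ e.target) (v : TangentSpace (𝓡 2) (e.symm y)) {a : Plane}
    (ha : mfderiv (𝓡 2) (𝓡 2) e (e.symm y) v = a) :
    v = a 0 • coordVec e y 0 + a 1 • coordVec e y 1 := by
  refine (mdifferentiable_of_mem_maximalAtlas he).mfderiv_injective (e.map_target hy) ?_
  rw [map_add, map_smul, map_smul, mfderiv_coordVec he hy, mfderiv_coordVec he hy, ha]
  exact plane_eq_sum a

lemma form_self_eq (g : PseudoMetric M) (he : e ∈ IsManifold.maximalAtlas (𝓡 2) ∞ M) {y : Plane}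
    (hy : y ∈ e.target) (X : SmoothField M) :
    g.form (e.symm y) (X.toFun (e.symm y)) (X.toFun (e.symm y)) =
      fieldCoord e X y 0 ^ 2 * g.coeff e y 0 0
        + 2 * fieldCoord e X y 0 * fieldCoord e X y 1 * g.coeff e y 0 1
        + fieldCoord e X y 1 ^ 2 * g.coeff e y 1 1 := by
  have h := eq_sum_coordVec he hy (X.toFun (e.symm y)) (a := fieldCoord e X y) rfl
  have hs := g.symm (e.symm y) (coordVec e y 1) (coordVec e y 0)
  rw [h]
  simp only [map_add, map_smul, _root_.add_apply, _root_.smul_apply,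
    smul_eq_mul, hs, PseudoMetric.coeff, Matrix.of_apply]
  ring

lemma coeff_isSymm (g : PseudoMetric M) (e : OpenPartialHomeomorph M Plane) (y : Plane) :
    (g.coeff e y).IsSymm :=
  Matrix.IsSymm.ext fun _ _ => g.symm _ _ _

lemma coeff_det_ne_zero (g : PseudoMetric M) (he : e ∈ IsManifold.maximalAtlas (𝓡 2) ∞ M)
    {y : Plane} (hy : y ∈ e.target) : (g.coeff e y).det ≠ 0 := by
  intro h0
  obtain ⟨c, hc, hc0⟩ := Matrix.exists_vecMul_eq_zero_iff.2 h0
  set w : TangentSpace (𝓡 2) (e.symm y) := c 0 • coordVec e y 0 + c 1 • coordVec e y 1 with hw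
  have hwm : ∀ m, g.form _ w (coordVec e y m) = 0 := by
    intro m
    have := congrFun hc0 m
    simp only [Matrix.vecMul, dotProduct, Fin.sum_univ_two, PseudoMetric.coeff, Matrix.of_apply,
      Pi.zero_apply] at this
    simp only [hw, map_add, map_smul, _root_.add_apply,
      _root_.smul_apply, smul_eq_mul]
    exact this
  have hw0 : w = 0 := g.nondegenerate _ _ fun v => by
    rw [eq_sum_coordVec he hy v rfl, map_add, map_smul, map_smul, hwm, hwm, smul_zero, smul_zero,
      add_zero]
  have h1 : mfderiv (𝓡 2) (𝓡 2) e (e.symm y) w = c 0 • stdVec 0 + c 1 • stdVec 1 := by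
    rw [hw, map_add, map_smul, map_smul, mfderiv_coordVec he hy, mfderiv_coordVec he hy]
    rfl
  rw [hw0, map_zero] at h1
  have h1 : (0 : Plane) = c 0 • stdVec 0 + c 1 • stdVec 1 := h1
  refine hc (funext fun k => ?_)
  have h2 := congrArg (fun v : Plane => v k) h1
  fin_cases k <;> simpa using h2.symm

lemma contDiffOn_fieldCoord (he : e ∈ IsManifold.maximalAtlas (𝓡 2) ∞ M) (X : SmoothField M) :
    ContDiffOn ℝ ∞ (fieldCoord e X) e.target := by
  have h1 : ContMDiffOn (𝓡 2) (𝓡 2).tangent ∞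
      (fun y => (⟨e.symm y, X.toFun (e.symm y)⟩ : TangentBundle (𝓡 2) M)) e.target :=
    X.smooth.comp_contMDiffOn (contMDiffOn_symm_of_mem_maximalAtlas he)
  have h2 := (contMDiffOn_of_mem_maximalAtlas he).contMDiffOn_tangentMapWithin (m := ∞)
    (by simp) e.open_source.uniqueMDiffOn
  have h3 := h2.comp h1 fun y hy => e.map_target hy
  have h4 := (contMDiff_snd_tangentBundle_modelSpace Plane (𝓡 2) (n := ∞)).comp_contMDiffOn h3
  rw [contMDiffOn_iff_contDiffOn] at h4
  refine h4.congr fun y hy => ?_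
  exact DFunLike.congr_fun
    (mfderivWithin_of_isOpen e.open_source (e.map_target hy)).symm (X.toFun (e.symm y))

lemma contMDiffOn_coordVec (he : e ∈ IsManifold.maximalAtlas (𝓡 2) ∞ M) (k : Fin 2) :
    ContMDiffOn (𝓡 2) (𝓡 2).tangent ∞
      (fun y => (⟨e.symm y, coordVec e y k⟩ : TangentBundle (𝓡 2) M)) e.target := by
  have h1 : ContMDiffOn (𝓡 2) (𝓡 2).tangent ∞
      (fun y => (⟨y, stdVec k⟩ : TangentBundle (𝓡 2) Plane)) e.target :=
    contMDiffOn_vectorSpace_iff_contDiffOn.2 contDiffOn_const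
  have h2 := (contMDiffOn_symm_of_mem_maximalAtlas he).contMDiffOn_tangentMapWithin (m := ∞)
    (by simp) e.open_target.uniqueMDiffOn
  refine (h2.comp h1 fun y hy => hy).congr fun y hy => ?_
  simp only [Function.comp_apply, tangentMapWithin, coordVec]
  rw [mfderivWithin_of_isOpen e.open_target hy]

lemma contDiffOn_coeff (g : PseudoMetric M) (he : e ∈ IsManifold.maximalAtlas (𝓡 2) ∞ M)
    (k m : Fin 2) : ContDiffOn ℝ ∞ (fun y => g.coeff e y k m) e.target := by
  have hg := g.smooth.comp_contMDiffOn (contMDiffOn_symm_of_mem_maximalAtlas he)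
  have h : ContMDiffOn (𝓡 2) ((𝓡 2).prod 𝓘(ℝ)) ∞
      (fun y => TotalSpace.mk' ℝ (E := Bundle.Trivial M ℝ) (e.symm y)
        (g.form (e.symm y) (coordVec e y k) (coordVec e y m))) e.target := by
    apply ContMDiffOn.clm_bundle_apply₂ (F₁ := Plane) (F₂ := Plane)
    · exact hg
    · exact contMDiffOn_coordVec he k
    · exact contMDiffOn_coordVec he m
  rw [← contMDiffOn_iff_contDiffOn]
  intro y hy
  have := h y hy
  simp only [contMDiffWithinAt_totalSpace] at this
  exact this.2

lemma continuous_form_self (g : PseudoMetric M) (X : SmoothField M) :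
    Continuous fun x => g.form x (X.toFun x) (X.toFun x) := by
  have h : ContMDiff (𝓡 2) ((𝓡 2).prod 𝓘(ℝ)) ∞
      (fun x => TotalSpace.mk' ℝ (E := Bundle.Trivial M ℝ) x
        (g.form x (X.toFun x) (X.toFun x))) := by
    apply ContMDiff.clm_bundle_apply₂ (F₁ := Plane) (F₂ := Plane)
    · exact g.smooth
    · exact X.smooth
    · exact X.smooth
  have h' : ContMDiff (𝓡 2) 𝓘(ℝ) ∞ fun x => g.form x (X.toFun x) (X.toFun x) := by
    intro x
    have := h x
    simp only [contMDiffAt_totalSpace] at this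
    exact this.2
  exact h'.continuous

lemma inv_apply_of_fin_two {A : Matrix (Fin 2) (Fin 2) ℝ} :
    A⁻¹ 0 0 = A.det⁻¹ * A 1 1 ∧ A⁻¹ 0 1 = A.det⁻¹ * -A 0 1 ∧
      A⁻¹ 1 0 = A.det⁻¹ * -A 1 0 ∧ A⁻¹ 1 1 = A.det⁻¹ * A 0 0 := by
  simp [Matrix.inv_def, Matrix.adjugate_fin_two]

lemma contDiffOn_coeff_inv (g : PseudoMetric M) (he : e ∈ IsManifold.maximalAtlas (𝓡 2) ∞ M)
    (k m : Fin 2) : ContDiffOn ℝ ∞ (fun y => (g.coeff e y)⁻¹ k m) e.target := by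
  have hc := contDiffOn_coeff g he
  have hdet : ContDiffOn ℝ ∞ (fun y => (g.coeff e y).det⁻¹) e.target := by
    refine ContDiffOn.inv ?_ fun y hy => coeff_det_ne_zero g he hy
    simp only [Matrix.det_fin_two]
    exact ((hc 0 0).mul (hc 1 1)).sub ((hc 0 1).mul (hc 1 0))
  fin_cases k <;> fin_cases m <;>
    simp only [Fin.zero_eta, Fin.mk_one, inv_apply_of_fin_two]
  · exact hdet.mul (hc 1 1)
  · exact hdet.mul (hc 0 1).neg
  · exact hdet.mul (hc 1 0).neg
  · exact hdet.mul (hc 0 0)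

lemma coeff_inv_isSymm (g : PseudoMetric M) (e : OpenPartialHomeomorph M Plane) (y : Plane) :
    ((g.coeff e y)⁻¹).IsSymm := by
  rw [Matrix.IsSymm, Matrix.transpose_nonsing_inv, coeff_isSymm g e y]

/-! ### Changes of coordinates -/

/-- Local coordinate changes produce new smooth charts, inside any prescribed neighbourhood. -/
lemma exists_chart (he : e ∈ IsManifold.maximalAtlas (𝓡 2) ∞ M) {x : M} (hx : x ∈ e.source)
    {f : Plane → Plane} (hf : ∀ᶠ y in 𝓝 (e x), ContDiffAt ℝ ∞ f y)
    (hinv : (fderiv ℝ f (e x)).IsInvertible) {W : Set Plane} (hW : W ∈ 𝓝 (e x)) :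
    ∃ e' ∈ IsManifold.maximalAtlas (𝓡 2) ∞ M, x ∈ e'.source ∧ e'.source ⊆ e.source ∧
      ∀ z ∈ e'.source, e z ∈ W ∧ e' z = f (e z) ∧ ContDiffAt ℝ ∞ f (e z) := by
  obtain ⟨ψ, hxψ, hψW, hψ, hψs, hψi, -⟩ := exists_local_diffeomorph hf hinv hW
  refine ⟨e.trans ψ, ?_, ?_, ?_, ?_⟩
  · apply OpenPartialHomeomorph.mem_maximalAtlas_of_contMDiffOn
    · have h1 : ContMDiffOn (𝓡 2) (𝓡 2) ∞ ψ ψ.source := by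
        rw [contMDiffOn_iff_contDiffOn]
        exact fun y hy => ((hψs y hy).congr_of_eventuallyEq
          (Eventually.of_forall hψ)).contDiffWithinAt
      rw [OpenPartialHomeomorph.coe_trans, OpenPartialHomeomorph.trans_source]
      exact h1.comp ((contMDiffOn_of_mem_maximalAtlas he).mono inter_subset_left)
        fun z hz => hz.2
    · have h1 : ContMDiffOn (𝓡 2) (𝓡 2) ∞ ψ.symm ψ.target := by
        rw [contMDiffOn_iff_contDiffOn]
        exact fun y hy => (hψi y hy).contDiffWithinAt
      rw [OpenPartialHomeomorph.coe_trans_symm, OpenPartialHomeomorph.trans_target]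
      exact (contMDiffOn_symm_of_mem_maximalAtlas he).comp (h1.mono inter_subset_left)
        fun z hz => hz.2
  · rw [OpenPartialHomeomorph.trans_source]; exact ⟨hx, hxψ⟩
  · rw [OpenPartialHomeomorph.trans_source]; exact inter_subset_left
  · intro z hz
    rw [OpenPartialHomeomorph.trans_source] at hz
    exact ⟨hψW hz.2, hψ _, hψs _ hz.2⟩

section ChartChange

variable {e' : OpenPartialHomeomorph M Plane} {f : Plane → Plane}

omit [IsManifold (𝓡 2) ∞ M] in
lemma mfderiv_chartChange (he : e ∈ IsManifold.maximalAtlas (𝓡 2) ∞ M)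
    (hsub : e'.source ⊆ e.source) (hf : ∀ z ∈ e'.source, e' z = f (e z)) {z : M}
    (hz : z ∈ e'.source) (hfz : DifferentiableAt ℝ f (e z)) (v : TangentSpace (𝓡 2) z) :
    mfderiv (𝓡 2) (𝓡 2) e' z v = fderiv ℝ f (e z) (mfderiv (𝓡 2) (𝓡 2) e z v) := by
  have h1 : HasMFDerivAt (𝓡 2) (𝓡 2) e z (mfderiv (𝓡 2) (𝓡 2) e z) :=
    ((mdifferentiable_of_mem_maximalAtlas he).mdifferentiableAt (hsub hz)).hasMFDerivAt
  have h2 : HasMFDerivAt (𝓡 2) (𝓡 2) f (e z) (fderiv ℝ f (e z)) := hfz.hasFDerivAt.hasMFDerivAt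
  have h3 := (h2.comp z h1).congr_of_eventuallyEq (f₁ := e') (by
    filter_upwards [e'.open_source.mem_nhds hz] with w hw
    exact hf w hw)
  rw [h3.mfderiv]
  rfl

lemma fieldCoord_chartChange (he : e ∈ IsManifold.maximalAtlas (𝓡 2) ∞ M)
    (hsub : e'.source ⊆ e.source) (hf : ∀ z ∈ e'.source, e' z = f (e z)) {z : M}
    (hz : z ∈ e'.source) (hfz : DifferentiableAt ℝ f (e z)) (X : SmoothField M) :
    fieldCoord e' X (e' z) = fderiv ℝ f (e z) (fieldCoord e X (e z)) := by
  rw [fieldCoord_apply hz, fieldCoord_apply (hsub hz)]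
  exact mfderiv_chartChange he hsub hf hz hfz _

/-- The metric coefficients at `z` in terms of vectors at `z` itself instead of vectors at
`e.symm (e z)`. -/
lemma coeff_apply (g : PseudoMetric M) (he : e ∈ IsManifold.maximalAtlas (𝓡 2) ∞ M) {z : M}
    (hz : z ∈ e.source) {b : Fin 2 → TangentSpace (𝓡 2) z}
    (hb : ∀ k, mfderiv (𝓡 2) (𝓡 2) e z (b k) = stdVec k) (k m : Fin 2) :
    g.coeff e (e z) k m = g.form z (b k) (b m) := by
  have key : ∀ y ∈ e.target, ∀ w, ∀ _ : e.symm y = w, ∀ b : Fin 2 → TangentSpace (𝓡 2) w,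
      (∀ k, mfderiv (𝓡 2) (𝓡 2) e w (b k) = stdVec k) →
      g.coeff e y k m = g.form w (b k) (b m) := by
    rintro y hy _ rfl b hb
    have h : ∀ k, b k = coordVec e y k := fun k =>
      (mdifferentiable_of_mem_maximalAtlas he).mfderiv_injective (e.map_target hy)
        ((hb k).trans (mfderiv_coordVec he hy k).symm)
    rw [h, h]
    rfl
  exact key _ (e.map_source hz) z (e.left_inv hz) b hb

/-- Behaviour of the metric coefficients under a change of coordinates with diagonal
differential. -/
lemma coeff_chartChange (g : PseudoMetric M) (he : e ∈ IsManifold.maximalAtlas (𝓡 2) ∞ M)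
    (he' : e' ∈ IsManifold.maximalAtlas (𝓡 2) ∞ M)
    (hsub : e'.source ⊆ e.source) (hf : ∀ z ∈ e'.source, e' z = f (e z)) {z : M}
    (hz : z ∈ e'.source) (hfz : DifferentiableAt ℝ f (e z)) {d : Fin 2 → ℝ}
    (hd : ∀ k, fderiv ℝ f (e z) (stdVec k) = d k • stdVec k) (k m : Fin 2) :
    g.coeff e (e z) k m = d k * d m * g.coeff e' (e' z) k m := by
  have hm := mdifferentiable_of_mem_maximalAtlas he
  have hm' := mdifferentiable_of_mem_maximalAtlas he'
  choose b hb using fun k => hm.mfderiv_surjective (hsub hz) (stdVec k)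
  choose b' hb' using fun k => hm'.mfderiv_surjective hz (stdVec k)
  have hbb : ∀ k, b k = d k • b' k := by
    intro k
    refine hm'.mfderiv_injective hz ?_
    rw [map_smul, hb', mfderiv_chartChange he hsub hf hz hfz, hb]
    exact hd k
  rw [coeff_apply g he (hsub hz) hb, coeff_apply g he' hz hb', hbb, hbb]
  simp only [map_smul, _root_.smul_apply, smul_eq_mul]
  ring

end ChartChange

end Coordinates

/-! ### Maps of the plane -/

section PlaneMaps

/-- Differential of a map into the plane given by its two components. -/
lemma hasFDerivAt_plane {u w : Plane → ℝ} {u' w' : Plane →L[ℝ] ℝ} {y : Plane}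
    (hu : HasFDerivAt u u' y) (hw : HasFDerivAt w w' y) :
    ∃ L : Plane →L[ℝ] Plane, HasFDerivAt (fun y => (!₂[u y, w y] : Plane)) L y ∧
      ∀ v, L v = !₂[u' v, w' v] := by
  refine ⟨((EuclideanSpace.equiv (Fin 2) ℝ).symm : (Fin 2 → ℝ) →L[ℝ] Plane).comp
    (ContinuousLinearMap.pi ![u', w']), ?_, ?_⟩
  · rw [← hasFDerivWithinAt_univ, hasFDerivWithinAt_euclidean]
    intro k
    rw [hasFDerivWithinAt_univ]
    fin_cases k
    · exact hu.congr_fderiv (by ext v; rfl)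
    · exact hw.congr_fderiv (by ext v; rfl)
  · intro v
    ext k
    fin_cases k <;> rfl

lemma contDiffAt_plane {u w : Plane → ℝ} {y : Plane} (hu : ContDiffAt ℝ ∞ u y)
    (hw : ContDiffAt ℝ ∞ w y) : ContDiffAt ℝ ∞ (fun y => (!₂[u y, w y] : Plane)) y := by
  rw [contDiffAt_euclidean]
  intro k
  fin_cases k
  · exact hu
  · exact hw

lemma isInvertible_of_surjective {L : Plane →L[ℝ] Plane} (hL : Function.Surjective L) :
    L.IsInvertible := by
  have hinj : Function.Injective (L : Plane →ₗ[ℝ] Plane) :=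
    LinearMap.injective_iff_surjective.2 hL
  refine ⟨(LinearEquiv.ofBijective (L : Plane →ₗ[ℝ] Plane) ⟨hinj, hL⟩).toContinuousLinearEquiv, ?_⟩
  ext v
  rfl

end PlaneMaps

/-! ### Functions of one coordinate and their normalization -/

section Normalization

/-- A function on a ball with vanishing derivative in the direction `x^k` depends on the other
coordinate only. -/
lemma eq_of_fderiv_eq_zero {h : Plane → ℝ} {y₀ : Plane} {r : ℝ}
    (hh : ContDiffOn ℝ ∞ h (Metric.ball y₀ r)) {k l : Fin 2} (hkl : k ≠ l)
    (hd : ∀ y ∈ Metric.ball y₀ r, fderiv ℝ h y (stdVec k) = 0) {y z : Plane}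
    (hy : y ∈ Metric.ball y₀ r) (hz : z ∈ Metric.ball y₀ r) (hyz : y l = z l) : h y = h z := by
  set c : ℝ := z k - y k with hc
  have hzy : z - y = c • stdVec k := by
    ext j
    fin_cases k <;> fin_cases l <;> fin_cases j <;> simp_all
  have hmem : ∀ t ∈ Icc (0 : ℝ) 1, y + t • (z - y) ∈ Metric.ball y₀ r := fun t ht =>
    (convex_ball y₀ r).add_smul_sub_mem hy hz ht
  have hder : ∀ t ∈ Icc (0 : ℝ) 1, HasDerivAt (fun t : ℝ => h (y + t • (z - y))) 0 t := by
    intro t ht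
    have h1 : HasDerivAt (fun t : ℝ => y + t • (z - y)) (z - y) t := by
      simpa using ((hasDerivAt_id t).smul_const (z - y)).const_add y
    have h2 := ((hh.contDiffAt (Metric.isOpen_ball.mem_nhds (hmem t ht))).differentiableAt
      (by simp)).hasFDerivAt
    have h3 := h2.comp_hasDerivAt t h1
    rw [hzy, map_smul, ← hzy, hd _ (hmem t ht), smul_zero] at h3
    exact h3
  have := constant_of_has_deriv_right_zero (f := fun t : ℝ => h (y + t • (z - y)))
    (a := 0) (b := 1) (fun t ht => (hder t ht).continuousAt.continuousWithinAt)
    (fun t ht => (hder t ⟨ht.1, ht.2.le⟩).hasDerivWithinAt) 1 (by simp)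
  simpa using this.symm

/-- A primitive of `|k|^{-1/2}` is a coordinate in which the function `k` becomes its sign. -/
lemma exists_primitive_inv_sqrt {k : ℝ → ℝ} {U : Set ℝ} (hU : IsOpen U)
    (hk : ContDiffOn ℝ ∞ k U) {s₀ : ℝ} (hs₀ : s₀ ∈ U) (hk0 : k s₀ ≠ 0) :
    ∃ ρ : ℝ → ℝ, ContDiff ℝ ∞ ρ ∧ ∃ ε ∈ ({-1, 0, 1} : Set ℝ),
      ∀ᶠ s in 𝓝 s₀, deriv ρ s ≠ 0 ∧ deriv ρ s ^ 2 * k s = ε := by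
  have hV : IsOpen (U ∩ k ⁻¹' {0}ᶜ) :=
    hk.continuousOn.isOpen_inter_preimage hU isOpen_compl_singleton
  have hc : ContDiffOn ℝ ∞ (fun s => (√|k s|)⁻¹) (U ∩ k ⁻¹' {0}ᶜ) := by
    intro s hs
    have h1 : ContDiffAt ℝ ∞ k s := hk.contDiffAt (hU.mem_nhds hs.1)
    have h2 : k s ≠ 0 := hs.2
    refine (((h1.abs h2).sqrt (abs_ne_zero.2 h2)).inv ?_).contDiffWithinAt
    exact (Real.sqrt_pos.2 (abs_pos.2 h2)).ne'
  obtain ⟨c, hcs, hceq⟩ := exists_contDiff_eventuallyEq hV hc ⟨hs₀, hk0⟩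
  have hderiv : ∀ s, HasDerivAt (fun s => ∫ t in s₀..s, c t) (c s) s := fun s =>
    hcs.continuous.integral_hasStrictDerivAt s₀ s |>.hasDerivAt
  have hderiv' : deriv (fun s => ∫ t in s₀..s, c t) = c := funext fun s => (hderiv s).deriv
  have hkc : ContinuousAt k s₀ := hk.continuousOn.continuousAt (hU.mem_nhds hs₀)
  refine ⟨fun s => ∫ t in s₀..s, c t, ?_, SignType.sign (k s₀), ?_, ?_⟩
  · rw [contDiff_infty_iff_deriv, hderiv']
    exact ⟨fun s => (hderiv s).differentiableAt, hcs⟩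
  · rcases lt_trichotomy (k s₀) 0 with h | h | h
    · simp [sign_neg h]
    · exact absurd h hk0
    · simp [sign_pos h]
  · rw [hderiv']
    have hsign : ∀ᶠ s in 𝓝 s₀, k s = SignType.sign (k s₀) * |k s| ∧ k s ≠ 0 := by
      rcases lt_or_gt_of_ne hk0 with h | h
      · filter_upwards [hkc.eventually_lt_const h] with s hs
        simp [sign_neg h, abs_of_neg hs, hs.ne]
      · filter_upwards [hkc.eventually_const_lt h] with s hs
        simp [sign_pos h, abs_of_pos hs, hs.ne']
    filter_upwards [hceq, hsign] with s h1 h2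
    have h3 : 0 < |k s| := abs_pos.2 h2.2
    rw [h1]
    refine ⟨inv_ne_zero (Real.sqrt_pos.2 h3).ne', ?_⟩
    rw [inv_pow, Real.sq_sqrt h3.le]
    nth_rewrite 2 [h2.1]
    field_simp

/-- A function of the coordinate `xˡ` alone, which is nonzero at `y₀` or zero near `y₀`, is
normalized to a constant `ε ∈ {-1, 0, 1}` by a change of the coordinate `xˡ`. -/
lemma exists_normalizing {h : Plane → ℝ} {y₀ : Plane} {r : ℝ} (hr : 0 < r)
    (hh : ContDiffOn ℝ ∞ h (Metric.ball y₀ r)) {k l : Fin 2} (hkl : k ≠ l)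
    (hd : ∀ y ∈ Metric.ball y₀ r, fderiv ℝ h y (stdVec k) = 0)
    (hnull : h y₀ ≠ 0 ∨ ∀ᶠ y in 𝓝 y₀, h y = 0) :
    ∃ ρ : ℝ → ℝ, ContDiff ℝ ∞ ρ ∧ ∃ ε ∈ ({-1, 0, 1} : Set ℝ),
      ∀ᶠ y in 𝓝 y₀, deriv ρ (y l) ≠ 0 ∧ deriv ρ (y l) ^ 2 * h y = ε := by
  rcases hnull with hnull | hnull
  · set γ : ℝ → Plane := fun s => y₀ + (s - y₀ l) • stdVec l with hγ
    have hγs : ContDiff ℝ ∞ γ :=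
      contDiff_const.add ((contDiff_id.sub contDiff_const).smul contDiff_const)
    have hγmem : ∀ s, |s - y₀ l| < r → γ s ∈ Metric.ball y₀ r := by
      intro s hs
      rw [Metric.mem_ball, dist_eq_norm, hγ]
      simpa [norm_smul] using hs
    have hU : IsOpen (γ ⁻¹' Metric.ball y₀ r) := Metric.isOpen_ball.preimage hγs.continuous
    have hs₀ : γ (y₀ l) = y₀ := by simp [hγ]
    obtain ⟨ρ, hρ, ε, hε, hev⟩ := exists_primitive_inv_sqrt hU
      (hh.comp hγs.contDiffOn fun s hs => hs) (s₀ := y₀ l)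
      (by rw [mem_preimage, hs₀]; exact Metric.mem_ball_self hr)
      (by simpa [hs₀] using hnull)
    refine ⟨ρ, hρ, ε, hε, ?_⟩
    have hcoord : ContinuousAt (fun y : Plane => y l) y₀ :=
      (EuclideanSpace.proj l : Plane →L[ℝ] ℝ).continuous.continuousAt
    filter_upwards [hcoord.eventually hev, Metric.ball_mem_nhds y₀ hr] with y h1 h2
    refine ⟨h1.1, ?_⟩
    have h3 : |y l - y₀ l| < r := by
      refine lt_of_le_of_lt ?_ (mem_ball_iff_norm.1 h2)
      simpa using PiLp.norm_apply_le (y - y₀) l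
    have h4 : h y = h (γ (y l)) :=
      eq_of_fderiv_eq_zero hh hkl hd h2 (hγmem _ h3) (by simp [hγ])
    rw [h4]
    exact h1.2
  · refine ⟨id, contDiff_id, 0, by simp, ?_⟩
    filter_upwards [hnull] with y hy
    simp [hy]

end Normalization

/-! ### Adapted charts and unique continuation on the surface -/

section Charts

variable {M : Type*} [TopologicalSpace M] [ChartedSpace Plane M] [IsManifold (𝓡 2) ∞ M]

lemma fieldCoord_eq_zero_iff {e : OpenPartialHomeomorph M Plane}
    (he : e ∈ IsManifold.maximalAtlas (𝓡 2) ∞ M) {z : M} (hz : z ∈ e.source)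
    (X : SmoothField M) : fieldCoord e X (e z) = 0 ↔ X.toFun z = 0 := by
  rw [fieldCoord_apply hz]
  exact map_eq_zero_iff _ ((mdifferentiable_of_mem_maximalAtlas he).mfderiv_injective hz)

lemma linearIndependent_fieldCoord_iff {e : OpenPartialHomeomorph M Plane}
    (he : e ∈ IsManifold.maximalAtlas (𝓡 2) ∞ M) {z : M} (hz : z ∈ e.source)
    (X Y : SmoothField M) : LinearIndependent ℝ ![fieldCoord e X (e z), fieldCoord e Y (e z)] ↔
      LinearIndependent ℝ ![X.toFun z, Y.toFun z] := by
  have key : ∀ s t : ℝ, s • fieldCoord e X (e z) + t • fieldCoord e Y (e z) = 0 ↔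
      s • X.toFun z + t • Y.toFun z = 0 := by
    intro s t
    rw [fieldCoord_apply hz, fieldCoord_apply hz,
      ← map_eq_zero_iff _ ((mdifferentiable_of_mem_maximalAtlas he).mfderiv_injective hz),
      map_add, map_smul, map_smul]
    rfl
  simp only [LinearIndependent.pair_iff, key]

/-- Two independent vector fields are simultaneously proportional to the coordinate fields of a
chart, whose coordinates are first integrals of the two fields. -/
theorem exists_adaptedChart {X Y : SmoothField M} {p : M}
    (hXY : LinearIndependent ℝ ![X.toFun p, Y.toFun p]) :
    ∃ e ∈ IsManifold.maximalAtlas (𝓡 2) ∞ M, p ∈ e.source ∧ ∀ y ∈ e.target,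
      fieldCoord e X y 0 ≠ 0 ∧ fieldCoord e X y 1 = 0 ∧
      fieldCoord e Y y 0 = 0 ∧ fieldCoord e Y y 1 ≠ 0 := by
  set e := chartAt Plane p with he_def
  have he : e ∈ IsManifold.maximalAtlas (𝓡 2) ∞ M := IsManifold.chart_mem_maximalAtlas p
  have hp : p ∈ e.source := mem_chart_source Plane p
  set a := fieldCoord e X with ha_def
  set b := fieldCoord e Y with hb_def
  set y₀ := e p with hy₀_def
  have hy₀ : y₀ ∈ e.target := e.map_source hp
  have ha := contDiffOn_fieldCoord he X
  have hb := contDiffOn_fieldCoord he Y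
  have hab : LinearIndependent ℝ ![a y₀, b y₀] :=
    (linearIndependent_fieldCoord_iff he hp X Y).2 hXY
  have hba : LinearIndependent ℝ ![b y₀, a y₀] := LinearIndependent.pair_symm_iff.1 hab
  obtain ⟨u, hu, hu1⟩ := exists_firstIntegral e.open_target hb hy₀ hba
  obtain ⟨w, hw, hw1⟩ := exists_firstIntegral e.open_target ha hy₀ hab
  set f : Plane → Plane := fun y => !₂[u y, w y] with hf_def
  have hfd : ∀ y, ContDiffAt ℝ ∞ u y → ContDiffAt ℝ ∞ w y →
      ∀ v, fderiv ℝ f y v = !₂[fderiv ℝ u y v, fderiv ℝ w y v] := by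
    intro y h1 h2 v
    obtain ⟨L, hL, hLv⟩ := hasFDerivAt_plane
      (h1.differentiableAt (by simp)).hasFDerivAt (h2.differentiableAt (by simp)).hasFDerivAt
    rw [hL.fderiv, hLv]
  have hf : ∀ᶠ y in 𝓝 y₀, ContDiffAt ℝ ∞ f y := by
    filter_upwards [hu, hw] with y h1 h2
    exact contDiffAt_plane h1.1 h2.1
  have hinv : (fderiv ℝ f y₀).IsInvertible := by
    refine isInvertible_of_surjective fun v => ⟨v 0 • a y₀ + v 1 • b y₀, ?_⟩
    have h1 := hfd y₀ hu.self_of_nhds.1 hw.self_of_nhds.1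
    rw [map_add, map_smul, map_smul, h1, h1, hu1, hw1, hu.self_of_nhds.2, hw.self_of_nhds.2]
    ext k
    fin_cases k <;> simp
  have hne : ∀ {h : Plane → ℝ} {c : Plane → Plane}, ContDiffAt ℝ ∞ h y₀ → ContinuousAt c y₀ →
      fderiv ℝ h y₀ (c y₀) = 1 → ∀ᶠ y in 𝓝 y₀, fderiv ℝ h y (c y) ≠ 0 := by
    intro h c h1 h2 h3
    have h4 : ContinuousAt (fun y => fderiv ℝ h y (c y)) y₀ :=
      (h1.fderiv_right (m := ∞) (by simp)).continuousAt.clm_apply h2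
    exact h4.eventually_ne (by rw [h3]; exact one_ne_zero)
  have hac : ContinuousAt a y₀ := (ha.continuousOn).continuousAt (e.open_target.mem_nhds hy₀)
  have hbc : ContinuousAt b y₀ := (hb.continuousOn).continuousAt (e.open_target.mem_nhds hy₀)
  obtain ⟨e', he', hp', hsub, he'z⟩ := exists_chart he hp hf hinv
    ((hu.and hw).and ((hne hu.self_of_nhds.1 hac hu1).and (hne hw.self_of_nhds.1 hbc hw1)))
  refine ⟨e', he', hp', fun y hy => ?_⟩
  set z := e'.symm y with hz_def
  have hz : z ∈ e'.source := e'.map_target hy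
  have hyz : y = e' z := (e'.right_inv hy).symm
  obtain ⟨⟨⟨h1, h2⟩, h3, h4⟩, -, h5⟩ := he'z z hz
  have hfc : ∀ V : SmoothField M, fieldCoord e' V y =
      !₂[fderiv ℝ u (e z) (fieldCoord e V (e z)), fderiv ℝ w (e z) (fieldCoord e V (e z))] := by
    intro V
    rw [hyz, fieldCoord_chartChange he hsub (fun z hz => (he'z z hz).2.1) hz
      (h5.differentiableAt (by simp)), hfd _ h1.1 h2.1]
  rw [hfc, hfc]
  exact ⟨h3, h2.2, h1.2, h4⟩

/-- The product of the fields vanishes identically on the fibre over `q` exactly when one of them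
vanishes at `q`. -/
lemma exists_factorized_ne_zero_iff {N : ℕ} (X : Fin N → SmoothField M) (q : M) :
    (∃ ξ : TangentSpace (𝓡 2) q →L[ℝ] ℝ, factorized X q ξ ≠ 0) ↔ ∀ m, (X m).toFun q ≠ 0 := by
  constructor
  · rintro ⟨ξ, hξ⟩ m hm
    exact hξ (Finset.prod_eq_zero (Finset.mem_univ m) (by rw [hm, map_zero]))
  · intro h
    by_contra! hcon
    set e := chartAt Plane q
    have he : e ∈ IsManifold.maximalAtlas (𝓡 2) ∞ M := IsManifold.chart_mem_maximalAtlas q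
    have hq : q ∈ e.source := mem_chart_source Plane q
    have hcon' : ∀ w, w = q → ∀ ξ : TangentSpace (𝓡 2) w →L[ℝ] ℝ, factorized X w ξ = 0 := by
      rintro _ rfl
      exact hcon
    have hprod : ∀ p, linearProd (fun m => fieldCoord e (X m)) (e q) p = 0 := by
      intro p
      rw [← factorizedCoord_eq]
      exact hcon' _ (e.left_inv hq) _
    obtain ⟨m, hm⟩ := exists_eq_zero_of_eventually_linearProd (p₀ := 0) (Eventually.of_forall hprod)
    exact h m ((fieldCoord_eq_zero_iff he hq (X m)).1 hm)

/-- An integral that does not vanish identically near `p` does not vanish identically near any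
point close to `p`, here in a given chart. -/
lemma eventually_frequently_fieldCoord_ne_zero (g : PseudoMetric M) {N : ℕ}
    {X : Fin N → SmoothField M} (hint : IsIntegral g X) {e : OpenPartialHomeomorph M Plane}
    (he : e ∈ IsManifold.maximalAtlas (𝓡 2) ∞ M) {p : M} (hp : p ∈ e.source)
    (hne : ∃ᶠ q in 𝓝 p, ∀ m, (X m).toFun q ≠ 0) :
    ∀ᶠ y in 𝓝 (e p), ∃ᶠ y' in 𝓝 y, ∀ m, fieldCoord e (X m) y' ≠ 0 := by
  refine eventually_frequently_ne_zero (G := fun y => (g.coeff e y)⁻¹) e.open_target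
    (fun m => contDiffOn_fieldCoord he (X m)) (contDiffOn_coeff_inv g he)
    (coeff_inv_isSymm g e) (fun y hy => ?_) (fun y hy q => ?_) (e.map_source hp) ?_
  · rw [Matrix.det_nonsing_inv, Ring.inverse_eq_inv']
    exact inv_ne_zero (coeff_det_ne_zero g he hy)
  · have := hint e he y hy q
    rwa [factorizedCoord_eq, hamiltonian_eq] at this
  · rw [← e.map_nhds_eq hp, frequently_map]
    refine (hne.and_eventually (e.open_source.mem_nhds hp)).mono fun q hq m => ?_
    exact fun h0 => hq.1 m ((fieldCoord_eq_zero_iff he hq.2 (X m)).1 h0)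

lemma eventually_frequently_toFun_ne_zero (g : PseudoMetric M) {N : ℕ}
    {X : Fin N → SmoothField M} (hint : IsIntegral g X) {p : M}
    (hne : ∃ᶠ q in 𝓝 p, ∀ m, (X m).toFun q ≠ 0) :
    ∀ᶠ x in 𝓝 p, ∃ᶠ q in 𝓝 x, ∀ m, (X m).toFun q ≠ 0 := by
  set e := chartAt Plane p
  have he : e ∈ IsManifold.maximalAtlas (𝓡 2) ∞ M := IsManifold.chart_mem_maximalAtlas p
  have hp : p ∈ e.source := mem_chart_source Plane p
  have h1 := eventually_frequently_fieldCoord_ne_zero g hint he hp hne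
  rw [← e.map_nhds_eq hp, eventually_map] at h1
  filter_upwards [h1, e.open_source.mem_nhds hp] with x hx hxs
  rw [← e.map_nhds_eq hxs, frequently_map] at hx
  refine (hx.and_eventually (e.open_source.mem_nhds hxs)).mono fun q hq m h0 => ?_
  exact hq.1 m ((fieldCoord_eq_zero_iff he hq.2 (X m)).2 h0)

end Charts

/-! ### Normal coordinates -/

section NormalForm

variable {M : Type*} [TopologicalSpace M] [ChartedSpace Plane M] [IsManifold (𝓡 2) ∞ M]

/-- In an adapted chart the product of fields is `p₁ p₂` times the remaining linear forms, up to a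
nonvanishing factor, which is absorbed into one of the remaining forms if there are any. -/
lemma integralNormalForm_of_adapted {N : ℕ} {X : Fin N → SmoothField M}
    {e : OpenPartialHomeomorph M Plane} (he : e ∈ IsManifold.maximalAtlas (𝓡 2) ∞ M)
    {i j : Fin N} (hij : i ≠ j)
    (had : ∀ y ∈ e.target, fieldCoord e (X i) y 0 ≠ 0 ∧ fieldCoord e (X i) y 1 = 0 ∧
      fieldCoord e (X j) y 0 = 0 ∧ fieldCoord e (X j) y 1 ≠ 0) :
    IntegralNormalForm X e := by
  set s : Finset (Fin N) := (Finset.univ.erase j).erase i with hs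
  have hcard : s.card = N - 2 := by
    rw [hs, Finset.card_erase_of_mem (by simp [hij]), Finset.card_erase_of_mem (by simp),
      Finset.card_univ, Fintype.card_fin]
    omega
  let σ : Fin (N - 2) ≃ s := (s.equivFinOfCardEq hcard).symm
  have hcomp : ∀ m k, ContDiffOn ℝ ∞ (fun y => fieldCoord e (X m) y k) e.target := fun m k =>
    (EuclideanSpace.proj k : Plane →L[ℝ] ℝ).contDiff.comp_contDiffOn (contDiffOn_fieldCoord he _)
  set c : Plane → ℝ := fun y => fieldCoord e (X i) y 0 * fieldCoord e (X j) y 1 with hc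
  have hcs : ContDiffOn ℝ ∞ c e.target := (hcomp i 0).mul (hcomp j 1)
  have hc0 : ∀ y ∈ e.target, c y ≠ 0 := fun y hy =>
    mul_ne_zero (had y hy).1 (had y hy).2.2.2
  have hprod : ∀ y ∈ e.target, ∀ p, factorizedCoord X e y p = c y * p 0 * p 1 *
      ∏ k : Fin (N - 2), (fieldCoord e (X (σ k)) y 0 * p 0 + fieldCoord e (X (σ k)) y 1 * p 1) := by
    intro y hy p
    obtain ⟨-, h1, h2, -⟩ := had y hy
    have h3 : ∏ k : Fin (N - 2),
        (fieldCoord e (X (σ k)) y 0 * p 0 + fieldCoord e (X (σ k)) y 1 * p 1) =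
        ∏ m ∈ s, (fieldCoord e (X m) y 0 * p 0 + fieldCoord e (X m) y 1 * p 1) := by
      rw [← Finset.prod_coe_sort s]
      exact Equiv.prod_comp σ fun m : s =>
        (fieldCoord e (X m) y 0 * p 0 + fieldCoord e (X m) y 1 * p 1)
    rw [h3, factorizedCoord_eq, linearProd,
      ← Finset.mul_prod_erase Finset.univ _ (Finset.mem_univ j),
      ← Finset.mul_prod_erase (Finset.univ.erase j) _ (Finset.mem_erase.2 ⟨hij, Finset.mem_univ i⟩)]
    simp only [Fin.sum_univ_two, h1, h2, hc]
    rw [Finset.prod_congr (rfl : s = s) fun m _ => show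
      p 0 * fieldCoord e (X m) y 0 + p 1 * fieldCoord e (X m) y 1 =
        fieldCoord e (X m) y 0 * p 0 + fieldCoord e (X m) y 1 * p 1 by ring]
    ring
  by_cases hN : 3 ≤ N
  · let k₀ : Fin (N - 2) := ⟨0, by omega⟩
    let d : Fin (N - 2) → Plane → ℝ := fun k y => if k = k₀ then c y else 1
    have hd : ∀ k, ContDiffOn ℝ ∞ (d k) e.target := by
      intro k
      by_cases hk : k = k₀
      · simpa only [d, hk, if_true] using hcs
      · simpa only [d, hk, if_false] using contDiffOn_const
    refine ⟨fun _ => 1, fun k y => d k y * fieldCoord e (X (σ k)) y 0,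
      fun k y => d k y * fieldCoord e (X (σ k)) y 1, contDiffOn_const, fun _ _ => one_ne_zero,
      fun _ _ _ => rfl, fun k => (hd k).mul (hcomp _ _), fun k => (hd k).mul (hcomp _ _), ?_⟩
    intro y hy p
    have h1 : ∏ k, d k y = c y := by simp [d]
    have h2 : ∏ k, (d k y * fieldCoord e (X (σ k)) y 0 * p 0 +
        d k y * fieldCoord e (X (σ k)) y 1 * p 1) =
        c y * ∏ k, (fieldCoord e (X (σ k)) y 0 * p 0 + fieldCoord e (X (σ k)) y 1 * p 1) := by
      rw [← h1, ← Finset.prod_mul_distrib]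
      exact Finset.prod_congr rfl fun _ _ => by ring
    rw [hprod y hy p, h2]
    ring
  · exact ⟨c, fun k y => fieldCoord e (X (σ k)) y 0, fun k y => fieldCoord e (X (σ k)) y 1,
      hcs, hc0, fun h => absurd h hN, fun k => hcomp _ _, fun k => hcomp _ _, hprod⟩

/-- The condition on the field in terms of the inverse metric: if the field is proportional to the
`k`-th coordinate field, it is null exactly where `G^{ll}` vanishes, `l ≠ k`. -/
lemma coeff_inv_ne_zero_or {g : PseudoMetric M} {X : SmoothField M}
    {e : OpenPartialHomeomorph M Plane} (he : e ∈ IsManifold.maximalAtlas (𝓡 2) ∞ M)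
    {k l : Fin 2} (hkl : k ≠ l)
    (hX : ∀ y ∈ e.target, fieldCoord e X y k ≠ 0 ∧ fieldCoord e X y l = 0) {p : M}
    (hp : p ∈ e.source) (hnull : NullConstantAt g X p) :
    (g.coeff e (e p))⁻¹ l l ≠ 0 ∨ ∀ᶠ y in 𝓝 (e p), (g.coeff e y)⁻¹ l l = 0 := by
  have key : ∀ y ∈ e.target, ((g.coeff e y)⁻¹ l l = 0 ↔
      g.form (e.symm y) (X.toFun (e.symm y)) (X.toFun (e.symm y)) = 0) := by
    intro y hy
    obtain ⟨h1, h2⟩ := hX y hy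
    have hdet := coeff_det_ne_zero g he hy
    rw [form_self_eq g he hy]
    fin_cases k <;> fin_cases l
    · exact absurd rfl hkl
    · simp only [Fin.zero_eta, Fin.mk_one] at h1 h2 ⊢
      simp [inv_apply_of_fin_two, h1, h2, hdet]
    · simp only [Fin.zero_eta, Fin.mk_one] at h1 h2 ⊢
      simp [inv_apply_of_fin_two, h1, h2, hdet]
    · exact absurd rfl hkl
  rcases hnull with h | h
  · left
    rw [Ne, key _ (e.map_source hp), e.left_inv hp]
    exact h
  · right
    have hsymm : Tendsto e.symm (𝓝 (e p)) (𝓝 p) := by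
      have := e.continuousAt_symm (e.map_source hp)
      rwa [ContinuousAt, e.left_inv hp] at this
    filter_upwards [hsymm.eventually h, e.open_target.mem_nhds (e.map_source hp)] with y h1 h2
    exact (key y h2).2 h1

/-- Normal coordinates exist at a point where both distinguished fields are either non-null or
null nearby. -/
theorem hasNormalCoordinates_of_nullConstantAt {g : PseudoMetric M} {N : ℕ}
    {X : Fin N → SmoothField M} (hint : IsIntegral g X) {p : M} {i j : Fin N}
    (hindep : LinearIndependent ℝ ![(X i).toFun p, (X j).toFun p])
    (hne : ∃ᶠ q in 𝓝 p, ∀ m, (X m).toFun q ≠ 0)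
    (hi : NullConstantAt g (X i) p) (hj : NullConstantAt g (X j) p) :
    HasNormalCoordinates g X p := by
  have hij : i ≠ j := by
    rintro rfl
    have := (LinearIndependent.pair_iff.1 hindep 1 (-1) (by simp)).1
    exact one_ne_zero this
  obtain ⟨e, he, hp, had⟩ := exists_adaptedChart hindep
  -- on a small ball both diagonal coefficients depend on one coordinate only
  obtain ⟨r, hr, hball⟩ := Metric.eventually_nhds_iff_ball.1
    ((e.open_target.eventually_mem (e.map_source hp)).and
      (eventually_frequently_fieldCoord_ne_zero g hint he hp hne))
  set B := Metric.ball (e p) r with hB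
  have hBt : B ⊆ e.target := fun y hy => (hball y hy).1
  have hG : ∀ k m, ContDiffOn ℝ ∞ (fun y => (g.coeff e y)⁻¹ k m) B := fun k m =>
    (contDiffOn_coeff_inv g he k m).mono hBt
  have hpois : ∀ y ∈ B, ∀ q, poisson (linearProd fun m => fieldCoord e (X m))
      (quadHamiltonian fun y => (g.coeff e y)⁻¹) y q = 0 := by
    intro y hy q
    have := hint e he y (hBt hy) q
    rwa [factorizedCoord_eq, hamiltonian_eq] at this
  have hdiag : ∀ {k l : Fin 2} {i : Fin N}, k ≠ l → (∀ y ∈ B, fieldCoord e (X i) y l = 0) →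
      ∀ y ∈ B, fderiv ℝ (fun y => (g.coeff e y)⁻¹ l l) y (stdVec k) = 0 := fun hkl h0 y hy =>
    fderiv_diagonal_eq_zero (a := fun m => fieldCoord e (X m)) Metric.isOpen_ball
      (fun m => (contDiffOn_fieldCoord he (X m)).mono hBt) hG hpois
      (fun y hy => (hball y hy).2) hkl h0 hy
  obtain ⟨ρ₁, hρ₁, ε₁, hε₁, hev₁⟩ := exists_normalizing hr (hG 0 0) (k := 1) (l := 0) (by simp)
    (hdiag (i := j) (by simp) fun y hy => (had y (hBt hy)).2.2.1)
    (coeff_inv_ne_zero_or he (k := 1) (l := 0) (by simp)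
      (fun y hy => ⟨(had y hy).2.2.2, (had y hy).2.2.1⟩) hp hj)
  obtain ⟨ρ₂, hρ₂, ε₂, hε₂, hev₂⟩ := exists_normalizing hr (hG 1 1) (k := 0) (l := 1) (by simp)
    (hdiag (i := i) (by simp) fun y hy => (had y (hBt hy)).2.1)
    (coeff_inv_ne_zero_or he (k := 0) (l := 1) (by simp)
      (fun y hy => ⟨(had y hy).1, (had y hy).2.1⟩) hp hi)
  set f : Plane → Plane := fun y => !₂[ρ₁ (y 0), ρ₂ (y 1)] with hf_def
  have hcoord : ∀ k : Fin 2, ContDiff ℝ ∞ fun y : Plane => y k := fun k =>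
    (EuclideanSpace.proj k : Plane →L[ℝ] ℝ).contDiff
  have hfs : ∀ y, ContDiffAt ℝ ∞ f y := fun y =>
    contDiffAt_plane (hρ₁.comp (hcoord 0)).contDiffAt (hρ₂.comp (hcoord 1)).contDiffAt
  have hfd : ∀ y v, fderiv ℝ f y v = !₂[deriv ρ₁ (y 0) * v 0, deriv ρ₂ (y 1) * v 1] := by
    intro y v
    have h1 : ∀ {ρ : ℝ → ℝ}, ContDiff ℝ ∞ ρ → ∀ k : Fin 2, HasFDerivAt (fun y : Plane => ρ (y k))
        (deriv ρ (y k) • (EuclideanSpace.proj k : Plane →L[ℝ] ℝ)) y := fun hρ k =>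
      ((hρ.differentiable (by simp)).differentiableAt.hasDerivAt).comp_hasFDerivAt y
        (EuclideanSpace.proj k : Plane →L[ℝ] ℝ).hasFDerivAt
    obtain ⟨L, hL, hLv⟩ := hasFDerivAt_plane (h1 hρ₁ 0) (h1 hρ₂ 1)
    rw [hL.fderiv, hLv]
    rfl
  have hinv : (fderiv ℝ f (e p)).IsInvertible := by
    refine isInvertible_of_surjective fun v =>
      ⟨!₂[(deriv ρ₁ (e p 0))⁻¹ * v 0, (deriv ρ₂ (e p 1))⁻¹ * v 1], ?_⟩
    have h1 := hev₁.self_of_nhds.1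
    have h2 := hev₂.self_of_nhds.1
    rw [hfd]
    ext k
    fin_cases k
    · simp [h1]
    · simp [h2]
  obtain ⟨e', he', hp', hsub, he'z⟩ := exists_chart he hp (Eventually.of_forall hfs) hinv
    (hev₁.and hev₂)
  have hchange : ∀ z ∈ e'.source, e' z = f (e z) := fun z hz => (he'z z hz).2.1
  refine ⟨e', he', hp', ⟨ε₁, hε₁, ε₂, hε₂,
    fun y => (1 / 2) * ((g.coeff e' y)⁻¹ 0 1 + (g.coeff e' y)⁻¹ 1 0), ?_, ?_⟩, ?_⟩
  · exact contDiffOn_const.mul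
      ((contDiffOn_coeff_inv g he' 0 1).add (contDiffOn_coeff_inv g he' 1 0))
  · intro y hy q
    obtain ⟨z, hz, rfl⟩ : ∃ z ∈ e'.source, e' z = y :=
      ⟨e'.symm y, e'.map_target hy, e'.right_inv hy⟩
    obtain ⟨⟨⟨hd1, h1⟩, hd2, h2⟩, -, -⟩ := he'z z hz
    have hco := coeff_chartChange g he he' hsub hchange hz ((hfs _).differentiableAt (by simp))
      (d := ![deriv ρ₁ (e z 0), deriv ρ₂ (e z 1)]) (by
        intro k
        rw [hfd]
        ext m
        fin_cases k <;> fin_cases m <;> simp)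
    have hdet := coeff_det_ne_zero g he' hy
    have hdet' : (g.coeff e (e z)).det = (deriv ρ₁ (e z 0) * deriv ρ₂ (e z 1)) ^ 2 *
        (g.coeff e' (e' z)).det := by
      simp only [Matrix.det_fin_two, hco, Matrix.cons_val_zero, Matrix.cons_val_one]
      ring
    have h00 : (g.coeff e' (e' z))⁻¹ 0 0 = ε₁ := by
      rw [← h1, inv_apply_of_fin_two.1, inv_apply_of_fin_two.1, hdet', hco]
      simp only [Matrix.cons_val_one, Matrix.cons_val_fin_one]
      field_simp
    have h11 : (g.coeff e' (e' z))⁻¹ 1 1 = ε₂ := by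
      rw [← h2, inv_apply_of_fin_two.2.2.2, inv_apply_of_fin_two.2.2.2, hdet', hco]
      simp only [Matrix.cons_val_zero]
      field_simp
    rw [hamiltonian_eq, quadHamiltonian_eq, h00, h11]
  · refine integralNormalForm_of_adapted he' hij fun y hy => ?_
    obtain ⟨z, hz, rfl⟩ : ∃ z ∈ e'.source, e' z = y :=
      ⟨e'.symm y, e'.map_target hy, e'.right_inv hy⟩
    obtain ⟨⟨⟨hd1, -⟩, hd2, -⟩, -, -⟩ := he'z z hz
    obtain ⟨h1, h2, h3, h4⟩ := had _ (e.map_source (hsub hz))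
    have hfc : ∀ V : SmoothField M, fieldCoord e' V (e' z) =
        !₂[deriv ρ₁ (e z 0) * fieldCoord e V (e z) 0,
          deriv ρ₂ (e z 1) * fieldCoord e V (e z) 1] := by
      intro V
      rw [fieldCoord_chartChange he hsub hchange hz ((hfs _).differentiableAt (by simp)), hfd]
    rw [hfc, hfc]
    exact ⟨mul_ne_zero hd1 h1, mul_eq_zero_of_right _ h2, mul_eq_zero_of_right _ h3,
      mul_ne_zero hd2 h4⟩

end NormalForm

end GeodesicFlow

theorem mainTheorem2 {M : Type*} [TopologicalSpace M] [ChartedSpace GeodesicFlow.Plane M]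
    [IsManifold (𝓡 2) ∞ M] (g : GeodesicFlow.PseudoMetric M)
    {N : ℕ} (X : Fin N → GeodesicFlow.SmoothField M)
    (hint : GeodesicFlow.IsIntegral g X)
    (p : M) (i j : Fin N)
    (hindep : LinearIndependent ℝ ![(X i).toFun p, (X j).toFun p])
    (hne : ∃ᶠ q in 𝓝 p, ∃ ξ : TangentSpace (𝓡 2) q →L[ℝ] ℝ,
      GeodesicFlow.factorized X q ξ ≠ 0) :
    closure {q : M | GeodesicFlow.HasNormalCoordinates g X q} ∈ 𝓝 p ∧
    (GeodesicFlow.NullConstantAt g (X i) p → GeodesicFlow.NullConstantAt g (X j) p →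
      GeodesicFlow.HasNormalCoordinates g X p) := by
  simp only [GeodesicFlow.exists_factorized_ne_zero_iff] at hne
  refine ⟨?_, GeodesicFlow.hasNormalCoordinates_of_nullConstantAt hint hindep hne⟩
  obtain ⟨e, he, hp, had⟩ := GeodesicFlow.exists_adaptedChart hindep
  have hindep' : ∀ q ∈ e.source, LinearIndependent ℝ ![(X i).toFun q, (X j).toFun q] := by
    intro q hq
    obtain ⟨h1, h2, h3, h4⟩ := had _ (e.map_source hq)
    rw [← GeodesicFlow.linearIndependent_fieldCoord_iff he hq, LinearIndependent.pair_iff]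
    intro s t hst
    have h5 := congrArg (fun v : GeodesicFlow.Plane => v 0) hst
    have h6 := congrArg (fun v : GeodesicFlow.Plane => v 1) hst
    simp [h2, h3] at h5 h6
    exact ⟨h5.resolve_right h1, h6.resolve_right h4⟩
  have hgood := (GeodesicFlow.eventually_frequently_toFun_ne_zero g hint hne).and
    (e.open_source.mem_nhds hp)
  obtain ⟨O, hO, hOo, hpO⟩ := eventually_nhds_iff.1 hgood
  refine mem_of_superset (hOo.mem_nhds hpO) fun q hq => mem_closure_iff.2 fun V hV hqV => ?_
  -- near a generic point each of the fields is non-null or null everywhere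
  obtain ⟨x, hx, hnull⟩ := GeodesicFlow.exists_forall_ne_or_eventually_eq
    (f := fun m x => g.form x ((X m).toFun x) ((X m).toFun x)) (hV.inter hOo) ⟨q, hqV, hq⟩
    fun m => (GeodesicFlow.continuous_form_self g (X m)).continuousOn
  exact ⟨x, hx.1, GeodesicFlow.hasNormalCoordinates_of_nullConstantAt hint
    (hindep' x (hO x hx.2).2) (hO x hx.2).1 (hnull i) (hnull j)⟩
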